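/- **Setting.** In round $n=0,1,2,\dots$ a learner is offered a finite nonempty set $\mathcal X_n\subset\mathbb R^d$ (possibly depending on the past) with $\|x\|\le L$ for all $x\in\mathcal X_n$, plays $x_n\in\mathcal X_n$, and receives a reward $y_n=\langle x_n,\theta_*\rangle+\eta_n$ and a set $\mathcal I_n$ of features reported as relevant. Here $\|\theta_*\|\le S$, $\theta_*$ is $k$-sparse ($|\operatorname{supp}\theta_*|\le k$), $\langle x,\theta_*\rangle\in[-1,1]$ for all offered $x$, and, given the past and $x_n$, $\eta_n$ is $R$-sub-Gaussian. The feedback is noisy: there is a fixed set $N$ of $k'$ irrelevant features, $N\cap\operatorname{supp}\theta_*=\emptyset$, such that $\mathcal I_n\subseteq\operatorname{supp}\theta_*\cup N$ always. Each relevant feature $j\in\operatorname{supp}\theta_*$ is discoverable: given the past, if the action of round $n$ is drawn uniformly from $\mathcal X_n$, then $j\in\mathcal I_n$ with probability at least $p\in(0,1]$. **FF-OFUL** (ridge parameter $\lambda>0$, confidence parameter $c$). Let $\mathcal R_n=\bigcup_{m<n}\mathcal I_m$ be the features known before round $n$. As long as $\mathcal R_n=\emptyset$ (initial phase), play uniformly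 random actions. Afterwards, in the loop rounds $t=1,2,\dots$: with probability $1/\sqrt t$ play a uniformly random offered action; otherwise play $x_n$ where $(x_n,\tilde\theta_n)$ maximizes $\langle x,\theta\rangle$ over $x\in\mathcal X_n$ and $\theta\in\mathcal C_n$. Here $\mathcal C_n\subset\mathbb R^{\mathcal R_n}$ is the OFUL ellipsoid $\{\theta:\|\hat\theta_n-\theta\|_{V_n}\le \beta_n\}$, $V_n=\lambda I+\sum_{m<n}x_mx_m^\top$, $\hat\theta_n=V_n^{-1}\sum_{m<n}y_mx_m$ (all vectors restricted to the coordinates in $\mathcal R_n$), and $$\beta_n=R\sqrt{|\mathcal R_n|\log\frac{1+nL^2/\lambda}{c}}+\sqrt\lambda\,S .$$ **Regret.** $R_T$ is the sum of $\max_{x\in\mathcal X_n}\langle x,\theta_*\rangle-\langle x_n,\theta_*\rangle$ over the initial phase and the loop rounds $t=1,\dots,T$. **Claim.** There is a universal exponent $a\in\mathbb N$, and for all $S,L,R\ge0$, $\lambda>0$ a constant $C>0$ depending only on $S,L,R,\lambda$, such that for every such problem, all $T\ge0$, all $\delta\in(0,1)$ and every confidence parameter $0<c\le\big(\tfrac{\delta}{4(k'+1)}\big)^2$,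 FF-OFUL satisfies, with probability at least $1-\delta$, $$R_T\le C\,\Big(\log\frac{3(T+1)(k+k'+1)}{p\,c}\Big)^{a}\Big((k+k')\sqrt T+\frac1{p^2}\Big).$$ That is, the regret of FF-OFUL scales as $\tilde O\big((k+k')\sqrt T+1/p^2\big)$. -/

import Mathlib

open MeasureTheory
open scoped Matrix

noncomputable section

namespace FFOFUL

/-- Feature space `ℝᵈ` with the Euclidean norm. -/
abbrev Vec (d : ℕ) := EuclideanSpace ℝ (Fin d)

/-- The support of a weight vector: the set of relevant features. -/
def supp {d : ℕ} (θ : Vec d) : Finset (Fin d) := Finset.univ.filter fun i => θ i ≠ 0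

/-- The vector `x` with all coordinates outside `A` erased (an element of `ℝᴬ`, kept inside `ℝᵈ`). -/
def restrict {d : ℕ} (A : Finset (Fin d)) (x : Vec d) : Fin d → ℝ :=
  fun i => if i ∈ A then x i else 0

/-- Regularized Gram matrix `XᵀX + λ I` of the actions of rounds `m < n`, restricted to the features
in `A`.  (On the coordinates outside `A` it is `λ` times the identity.) -/
def gram {d : ℕ} (lam : ℝ) (A : Finset (Fin d)) (x : ℕ → Vec d) (n : ℕ) :
    Matrix (Fin d) (Fin d) ℝ :=
  lam • (1 : Matrix (Fin d) (Fin d) ℝ) +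
    ∑ m ∈ Finset.range n, Matrix.vecMulVec (restrict A (x m)) (restrict A (x m))

/-- Ridge regression estimate from the rounds `m < n`, restricted to the features in `A`
(its coordinates outside `A` vanish). -/
def ridge {d : ℕ} (lam : ℝ) (A : Finset (Fin d)) (x : ℕ → Vec d) (y : ℕ → ℝ) (n : ℕ) :
    Fin d → ℝ :=
  (gram lam A x n)⁻¹ *ᵥ ∑ m ∈ Finset.range n, y m • restrict A (x m)

/-- The OFUL confidence radius of Abbasi-Yadkori, Pál and Szepesvári for `r` features and `n` samples,
with noise level `R`, action bound `L`, parameter bound `S`, ridge parameter `lam` and confidence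
parameter `c`: `R √(r log((1 + n L² / λ) / c)) + √λ S`. -/
def radius (S L R lam c : ℝ) (r n : ℕ) : ℝ :=
  R * Real.sqrt (r * Real.log ((1 + n * L ^ 2 / lam) / c)) + Real.sqrt lam * S

/-- The OFUL confidence ellipsoid in `ℝᴬ`, computed from the rounds `m < n`. -/
def confidenceSet {d : ℕ} (S L R lam c : ℝ) (A : Finset (Fin d)) (x : ℕ → Vec d) (y : ℕ → ℝ)
    (n : ℕ) : Set (Vec d) :=
  {θ | (∀ i, i ∉ A → θ i = 0) ∧
    Real.sqrt ((ridge lam A x y n - θ.ofLp) ⬝ᵥ (gram lam A x n *ᵥ (ridge lam A x y n - θ.ofLp)))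
      ≤ radius S L R lam c A.card n}

/-- The random variables of an interaction of a learner with a user.  Rounds are numbered
`n = 0, 1, 2, …`, starting with the first round of the initial random phase. -/
structure Interaction (Ω : Type*) (d : ℕ) where
  /-- the finite set of actions offered in round `n` -/
  actions : ℕ → Ω → Finset (Vec d)
  /-- does round `n` explore, that is, draw its action uniformly at random? -/
  explore : ℕ → Ω → Bool
  /-- the action played in round `n` -/
  action : ℕ → Ω → Vec d
  /-- the reward received in round `n` -/
  reward : ℕ → Ω → ℝ
  /-- the features reported as relevant in round `n` -/
  feedback : ℕ → Ω → Finset (Fin d)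

namespace Interaction

variable {Ω : Type*} {d : ℕ} (E : Interaction Ω d)

/-- The features reported before round `n`. -/
def known (n : ℕ) (ω : Ω) : Finset (Fin d) :=
  (Finset.range n).biUnion fun m => E.feedback m ω

/-- The index `t` of round `n` in the main loop of the algorithm, which starts at `t = 1` as soon as
some feature is known; it is `0` in the initial phase. -/
def loopIndex (n : ℕ) (ω : Ω) : ℕ :=
  ((Finset.range (n + 1)).filter fun m => (E.known m ω).Nonempty).card

/-- The exploration probability: `1` in the initial phase and `1 / √t` in round `t` of the loop. -/
def exploreProb (n : ℕ) (ω : Ω) : ℝ :=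
  if E.loopIndex n ω = 0 then 1 else 1 / Real.sqrt (E.loopIndex n ω)

/-- Instantaneous regret of round `n`. -/
def instRegret (θ : Vec d) (n : ℕ) (ω : Ω) : ℝ :=
  sSup ((fun x => inner ℝ x θ) '' (E.actions n ω : Set (Vec d))) - inner ℝ (E.action n ω) θ

/-- Cumulative regret of the whole initial phase and of the rounds `t = 1, …, T` of the loop. -/
def regret (θ : Vec d) (T : ℕ) (ω : Ω) : ENNReal :=
  ∑' n : ℕ, if E.loopIndex n ω ≤ T then ENNReal.ofReal (E.instRegret θ n ω) else 0

open scoped Classical in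
/-- The number of actions offered in round `n` that lie in `B`. -/
def actionCount (n : ℕ) (B : Set (Vec d)) (ω : Ω) : ℕ :=
  ((E.actions n ω).filter fun x => x ∈ B).card

/-- The sparse linear bandit with (possibly noisy) feature feedback.  `ℱ n` is the information before
round `n`, and `𝒢 n` the information in round `n` just after its action is chosen.  Rewards are
linear with weight vector `θ` and conditionally `R`-sub-Gaussian noise; only features from `supp θ`
and from the fixed set `N` are ever reported; and whenever the action is drawn uniformly at random,
each relevant feature is reported with conditional probability at least `p`. -/
structure IsFeatureFeedbackModel [mΩ : MeasurableSpace Ω] (μ : Measure Ω)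
    (ℱ 𝒢 : Filtration ℕ mΩ) (θ : Vec d) (N : Finset (Fin d)) (S L R p : ℝ) : Prop where
  before_le : ∀ n, ℱ n ≤ 𝒢 n
  le_next : ∀ n, 𝒢 n ≤ ℱ (n + 1)
  actions_nonempty : ∀ n ω, (E.actions n ω).Nonempty
  measurable_actions : ∀ n B, MeasurableSet B → Measurable[ℱ n] (E.actionCount n B)
  measurable_explore : ∀ n, Measurable[𝒢 n] (E.explore n)
  measurable_action : ∀ n, Measurable[𝒢 n] (E.action n)
  measurable_reward : ∀ n, Measurable[ℱ (n + 1)] (E.reward n)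
  measurable_feedback : ∀ n j, MeasurableSet[ℱ (n + 1)] {ω | j ∈ E.feedback n ω}
  norm_weight_le : ‖θ‖ ≤ S
  norm_action_le : ∀ n ω, ∀ x ∈ E.actions n ω, ‖x‖ ≤ L
  mean_reward_mem : ∀ n ω, ∀ x ∈ E.actions n ω, inner ℝ x θ ∈ Set.Icc (-1 : ℝ) 1
  integrable_noise : ∀ n (s : ℝ),
    Integrable (fun ω => Real.exp (s * (E.reward n ω - inner ℝ (E.action n ω) θ))) μ
  subgaussian_noise : ∀ n (s : ℝ),
    condExp (𝒢 n) μ (fun ω => Real.exp (s * (E.reward n ω - inner ℝ (E.action n ω) θ)))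
      ≤ᵐ[μ] fun _ => Real.exp (s ^ 2 * R ^ 2 / 2)
  feedback_subset : ∀ n ω, E.feedback n ω ⊆ supp θ ∪ N
  discoverable : ∀ n, ∀ j ∈ supp θ,
    (fun ω => p * condExp (ℱ n) μ ({ω | E.explore n ω = true}.indicator fun _ => (1 : ℝ)) ω)
      ≤ᵐ[μ] condExp (ℱ n) μ
        ({ω | E.explore n ω = true ∧ j ∈ E.feedback n ω}.indicator fun _ => (1 : ℝ))

/-- The actions are chosen by FF-OFUL, run with confidence parameter `c`: given the past, round `n`
explores with probability `exploreProb` and then draws a uniformly random action; otherwise it plays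
an action that, with some parameter, maximizes `⟨x, θ'⟩` over the actions offered and the OFUL
confidence ellipsoid computed from all previous rounds on the features known so far. -/
structure IsFFOFUL [mΩ : MeasurableSpace Ω] (μ : Measure Ω) (ℱ : Filtration ℕ mΩ)
    (S L R lam c : ℝ) : Prop where
  action_mem : ∀ n ω, E.action n ω ∈ E.actions n ω
  explore_uniform : ∀ n B, MeasurableSet B →
    condExp (ℱ n) μ
        ({ω | E.explore n ω = true ∧ E.action n ω ∈ B}.indicator fun _ => (1 : ℝ))
      =ᵐ[μ] fun ω =>
        E.exploreProb n ω * ((E.actionCount n B ω : ℝ) / ((E.actions n ω).card : ℝ))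
  exploit_optimistic : ∀ n ω, E.explore n ω = false →
    ∃ θ₁ ∈ confidenceSet S L R lam c (E.known n ω) (fun m => E.action m ω)
        (fun m => E.reward m ω) n,
      ∀ x ∈ E.actions n ω,
        ∀ θ₂ ∈ confidenceSet S L R lam c (E.known n ω) (fun m => E.action m ω)
            (fun m => E.reward m ω) n,
          inner ℝ x θ₂ ≤ inner ℝ (E.action n ω) θ₁

end Interaction

end FFOFUL

end

/-! Three events, each failing with small probability, force the regret bound path by path.

Discovery. Round `k`, counted from `0`, explores with probability at least `1/√(k+1)`, so the
exploration probabilities of the first `n` rounds add up to at least `√n`. A given relevant feature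
is then still unknown with probability at most `exp (-p√n)`. With `a = log (4s/δ)` and `s = |supp
θ|`, taking `n = ⌈(a/p)²⌉` reveals all relevant features; these rounds cost at most `2n`, which is
the `1/p²` term.

Exploration. In the `T` rounds from `n` on, the number of explorations is at most twice the sum of
their probabilities plus `a`, hence at most `4√T + a`.

Confidence. The known set depends on the data, so the self-normalized bound cannot be applied to it
directly. Once it contains `supp θ`, it equals `supp θ ∪ B` for some `B ⊆ N`, and a union bound runs
over all `2^k'` such sets. This is affordable because the radius contains `|A| log (1/c)`: the
ellipsoids on a fixed set `A` fail with probability at most `√c ^ |A|`, and the sum over `B` factors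
as `√c ^ s (1 + √c) ^ k' ≤ 2√c`. The condition on `c` makes this at most `δ/2`.

On these events optimism bounds the regret of an exploiting round by the width of its ellipsoid in
the direction played. The difference of two elements of the ellipsoid is supported on the known
features, so its Gram norm is the same on the fixed larger set `supp θ ∪ N`. The elliptic potential
lemma and Cauchy–Schwarz on that single set give `(k + k')√T` up to logarithms, however the known
set grows.

The pathwise half rests on `instRegret_le` and `regret_le`, the probabilistic half on
`mul_measure_exists_ge_le` and `lintegral_mul_mixRatio_le`; `measure_regret_gt_le` joins them. -/

namespace FFOFUL

/-! ### Rank-one updates and inequalities for positive definite forms. -/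

section MatrixLemmas

variable {ι : Type*} [Fintype ι]

theorem posDef_add_vecMulVec_self {V : Matrix ι ι ℝ} (hV : V.PosDef) (u : ι → ℝ) :
    (V + Matrix.vecMulVec u u).PosDef := by
  have h := Matrix.posSemidef_vecMulVec_self_star u
  rw [star_trivial] at h
  exact hV.add_posSemidef h

theorem dotProduct_mulVec_symm {V : Matrix ι ι ℝ} (hV : V.IsHermitian) (u v : ι → ℝ) :
    u ⬝ᵥ (V *ᵥ v) = v ⬝ᵥ (V *ᵥ u) := by
  have h : Vᵀ = V := by simpa [Matrix.IsHermitian] using hV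
  rw [Matrix.dotProduct_mulVec, ← Matrix.mulVec_transpose, h, dotProduct_comm]

theorem vecMulVec_mulVec' (u v w : ι → ℝ) :
    Matrix.vecMulVec u v *ᵥ w = (v ⬝ᵥ w) • u := by
  ext i
  simp only [Matrix.mulVec, Matrix.vecMulVec_apply, dotProduct, Pi.smul_apply, smul_eq_mul,
    Finset.sum_mul]
  exact Finset.sum_congr rfl fun _ _ => by ring

theorem quadForm_nonneg {V : Matrix ι ι ℝ} (hV : V.PosDef) (u : ι → ℝ) :
    0 ≤ u ⬝ᵥ (V *ᵥ u) := by
  simpa using hV.posSemidef.dotProduct_mulVec_nonneg u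

theorem quadForm_neg (V : Matrix ι ι ℝ) (u : ι → ℝ) :
    (-u) ⬝ᵥ (V *ᵥ (-u)) = u ⬝ᵥ (V *ᵥ u) := by
  simp [Matrix.mulVec_neg]

variable [DecidableEq ι]

theorem det_add_vecMulVec_self {V : Matrix ι ι ℝ} (hV : V.PosDef) (u : ι → ℝ) :
    (V + Matrix.vecMulVec u u).det = V.det * (1 + u ⬝ᵥ (V⁻¹ *ᵥ u)) := by
  rw [Matrix.vecMulVec_eq Unit, Matrix.det_add_replicateCol_mul_replicateRow hV.det_pos.ne'.isUnit]
  congr 1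
  rw [Matrix.det_unique, Matrix.add_apply, Matrix.one_apply_eq, Matrix.mul_assoc,
    ← Matrix.replicateCol_mulVec]
  simp [Matrix.mul_apply, dotProduct]

theorem mulVec_inv_cancel {V : Matrix ι ι ℝ} (hV : V.PosDef) (u : ι → ℝ) :
    V *ᵥ (V⁻¹ *ᵥ u) = u := by
  rw [Matrix.mulVec_mulVec, Matrix.mul_nonsing_inv _ hV.det_pos.ne'.isUnit, Matrix.one_mulVec]

theorem inv_mulVec_cancel {V : Matrix ι ι ℝ} (hV : V.PosDef) (u : ι → ℝ) :
    V⁻¹ *ᵥ (V *ᵥ u) = u := by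
  rw [Matrix.mulVec_mulVec, Matrix.nonsing_inv_mul _ hV.det_pos.ne'.isUnit, Matrix.one_mulVec]

/-- The effect of one more observation on the self-normalized quadratic form. -/
theorem inv_quadForm_add_vecMulVec_self {V : Matrix ι ι ℝ} (hV : V.PosDef) (s u : ι → ℝ) (z : ℝ) :
    (s + z • u) ⬝ᵥ ((V + Matrix.vecMulVec u u)⁻¹ *ᵥ (s + z • u)) =
      s ⬝ᵥ (V⁻¹ *ᵥ s) +
        (2 * z * (u ⬝ᵥ (V⁻¹ *ᵥ s)) + z ^ 2 * (u ⬝ᵥ (V⁻¹ *ᵥ u)) - (u ⬝ᵥ (V⁻¹ *ᵥ s)) ^ 2) /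
          (1 + u ⬝ᵥ (V⁻¹ *ᵥ u)) := by
  have hw : 0 ≤ u ⬝ᵥ (V⁻¹ *ᵥ u) := quadForm_nonneg hV.inv u
  have hsu : s ⬝ᵥ (V⁻¹ *ᵥ u) = u ⬝ᵥ (V⁻¹ *ᵥ s) := dotProduct_mulVec_symm hV.inv.1 s u
  set a := u ⬝ᵥ (V⁻¹ *ᵥ s) with ha
  set w := u ⬝ᵥ (V⁻¹ *ᵥ u) with hwdef
  have hw1 : (1 + w) ≠ 0 := by positivity
  -- Sherman–Morrison, verified by applying `V + u uᵀ` to the claimed solution.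
  have key : (V + Matrix.vecMulVec u u)⁻¹ *ᵥ (s + z • u) =
      V⁻¹ *ᵥ s + ((z - a) / (1 + w)) • (V⁻¹ *ᵥ u) := by
    rw [← inv_mulVec_cancel (posDef_add_vecMulVec_self hV u)
      (V⁻¹ *ᵥ s + ((z - a) / (1 + w)) • (V⁻¹ *ᵥ u))]
    congr 1
    rw [Matrix.add_mulVec, vecMulVec_mulVec', Matrix.mulVec_add, Matrix.mulVec_smul,
      mulVec_inv_cancel hV, mulVec_inv_cancel hV, dotProduct_add, dotProduct_smul, ← ha, ← hwdef,
      add_assoc, ← add_smul]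
    congr 2
    rw [smul_eq_mul]
    field_simp
    ring
  rw [key, dotProduct_add, add_dotProduct, add_dotProduct, smul_dotProduct, smul_dotProduct,
    dotProduct_smul, dotProduct_smul, hsu, ← ha, ← hwdef]
  simp only [smul_eq_mul]
  field_simp
  ring

/-- Cauchy–Schwarz for dual norms: the `V`-norm squared of `v - t V⁻¹x` is a nonnegative quadratic
in `t`, so its discriminant is nonpositive. -/
theorem dotProduct_sq_le {V : Matrix ι ι ℝ} (hV : V.PosDef) (x v : ι → ℝ) :
    (x ⬝ᵥ v) ^ 2 ≤ (x ⬝ᵥ (V⁻¹ *ᵥ x)) * (v ⬝ᵥ (V *ᵥ v)) := by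
  have h : ∀ t : ℝ, 0 ≤ (x ⬝ᵥ (V⁻¹ *ᵥ x)) * (t * t) + (-2 * (x ⬝ᵥ v)) * t + v ⬝ᵥ (V *ᵥ v) := by
    intro t
    have h0 := quadForm_nonneg hV (v - t • (V⁻¹ *ᵥ x))
    rw [Matrix.mulVec_sub, Matrix.mulVec_smul, mulVec_inv_cancel hV, dotProduct_sub,
      dotProduct_smul, sub_dotProduct, sub_dotProduct, smul_dotProduct, smul_dotProduct,
      dotProduct_comm (V⁻¹ *ᵥ x) x, dotProduct_comm (V⁻¹ *ᵥ x) (V *ᵥ v),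
      dotProduct_mulVec_symm hV.inv.1 (V *ᵥ v) x, inv_mulVec_cancel hV, dotProduct_comm v x] at h0
    simp only [smul_eq_mul] at h0
    linarith
  have := discrim_le_zero h
  rw [discrim] at this
  linarith

theorem dotProduct_le_sqrt {V : Matrix ι ι ℝ} (hV : V.PosDef) (x v : ι → ℝ) :
    x ⬝ᵥ v ≤ Real.sqrt (x ⬝ᵥ (V⁻¹ *ᵥ x)) * Real.sqrt (v ⬝ᵥ (V *ᵥ v)) := by
  rw [← Real.sqrt_mul (quadForm_nonneg hV.inv x)]
  exact Real.le_sqrt_of_sq_le (dotProduct_sq_le hV x v)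

theorem sqrt_quadForm_add_le {V : Matrix ι ι ℝ} (hV : V.PosDef) (u v : ι → ℝ) :
    Real.sqrt ((u + v) ⬝ᵥ (V *ᵥ (u + v))) ≤
      Real.sqrt (u ⬝ᵥ (V *ᵥ u)) + Real.sqrt (v ⬝ᵥ (V *ᵥ v)) := by
  have h := dotProduct_le_sqrt hV (V *ᵥ u) v
  rw [inv_mulVec_cancel hV, dotProduct_comm (V *ᵥ u) u, dotProduct_comm (V *ᵥ u) v] at h
  apply Real.sqrt_le_iff.2 ⟨by positivity, ?_⟩
  rw [add_sq, Real.sq_sqrt (quadForm_nonneg hV u), Real.sq_sqrt (quadForm_nonneg hV v),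
    Matrix.mulVec_add, dotProduct_add, add_dotProduct, add_dotProduct,
    dotProduct_mulVec_symm hV.1 u v]
  linarith

/-- If `V ≥ l I` then `V⁻¹ ≤ l⁻¹ I`. -/
theorem inv_quadForm_le {V : Matrix ι ι ℝ} (hV : V.PosDef) {l : ℝ} (hl : 0 < l)
    (h : ∀ v : ι → ℝ, l * (v ⬝ᵥ v) ≤ v ⬝ᵥ (V *ᵥ v)) (x : ι → ℝ) :
    l * (x ⬝ᵥ (V⁻¹ *ᵥ x)) ≤ x ⬝ᵥ x := by
  set v := V⁻¹ *ᵥ x with hv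
  have h1 := h v
  rw [hv, mulVec_inv_cancel hV, ← hv, dotProduct_comm v x] at h1
  -- Expanding this square and inserting `l (v ⬝ᵥ v) ≤ x ⬝ᵥ v` from `h1` gives the claim.
  have h2 : 0 ≤ (x - l • v) ⬝ᵥ (x - l • v) := by
    simpa using dotProduct_star_self_nonneg (x - l • v)
  rw [dotProduct_sub, sub_dotProduct, sub_dotProduct, dotProduct_smul, dotProduct_smul,
    smul_dotProduct, smul_dotProduct, dotProduct_comm v x] at h2
  simp only [smul_eq_mul] at h2
  nlinarith

/-- Evaluate the factored characteristic polynomial at `-l`; the signs on both sides cancel. -/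
theorem det_smul_one_add {B : Matrix ι ι ℝ} (hB : B.IsHermitian) (l : ℝ) :
    (l • (1 : Matrix ι ι ℝ) + B).det = ∏ i, (l + hB.eigenvalues i) := by
  have h := congrArg (Polynomial.eval (-l)) hB.charpoly_eq
  rw [Matrix.eval_charpoly, Polynomial.eval_prod] at h
  have h2 : Matrix.scalar ι (-l) - B = -(l • (1 : Matrix ι ι ℝ) + B) := by
    ext i j
    simp [Matrix.scalar_apply, Matrix.diagonal_apply, Matrix.one_apply]
    split_ifs <;> ring
  rw [h2, Matrix.det_neg] at h
  have h3 : ∀ i, Polynomial.eval (-l) (Polynomial.X - Polynomial.C (hB.eigenvalues i : ℝ)) =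
      (-1) * (l + hB.eigenvalues i) := by
    intro i; simp; ring
  simp only [RCLike.ofReal_real_eq_id, id] at h
  rw [Finset.prod_congr rfl fun i _ => h3 i, Finset.prod_mul_distrib, Finset.prod_const,
    Finset.card_univ] at h
  exact mul_left_cancel₀ (pow_ne_zero _ (by norm_num)) h

/-- Every eigenvalue is at most the trace and only `rank B` of them are nonzero. The exponent is
thus governed by the rank, which keeps the ambient dimension out of the regret. -/
theorem det_smul_one_add_le {B : Matrix ι ι ℝ} (hB : B.PosSemidef) {l t : ℝ} (hl : 0 < l)
    (ht : B.trace ≤ t) {r : ℕ} (hr : B.rank ≤ r) :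
    (l • (1 : Matrix ι ι ℝ) + B).det ≤ l ^ Fintype.card ι * (1 + t / l) ^ r := by
  have h0 := hB.eigenvalues_nonneg
  have htr : B.trace = ∑ i, hB.1.eigenvalues i := by
    simpa using hB.1.trace_eq_sum_eigenvalues
  have hle : ∀ i, hB.1.eigenvalues i ≤ t := fun i =>
    (Finset.single_le_sum (fun j _ => h0 j) (Finset.mem_univ i)).trans (htr ▸ ht)
  have ht0 : 0 ≤ t := le_trans (htr ▸ Finset.sum_nonneg fun j _ => h0 j) ht
  have h1 : 1 ≤ 1 + t / l := by
    have : 0 ≤ t / l := by positivity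
    linarith
  calc (l • (1 : Matrix ι ι ℝ) + B).det
      = ∏ i, (l + hB.1.eigenvalues i) := det_smul_one_add hB.1 l
    _ ≤ ∏ i, (l * if hB.1.eigenvalues i ≠ 0 then (1 + t / l) else 1) := by
        refine Finset.prod_le_prod (fun i _ => add_nonneg hl.le (h0 i)) fun i _ => ?_
        split_ifs with h
        · have : l * (1 + t / l) = l + t := by field_simp
          rw [this]
          linarith [hle i]
        · push Not at h
          rw [h]; simp
    _ = l ^ Fintype.card ι * (1 + t / l) ^ B.rank := by
        rw [Finset.prod_mul_distrib, Finset.prod_const, Finset.card_univ,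
          hB.1.rank_eq_card_non_zero_eigs, ← Finset.prod_filter, Finset.prod_const,
          Fintype.card_subtype]
    _ ≤ _ := by gcongr

end MatrixLemmas

/-! ### The regularized Gram matrix, elliptic potential and ridge regression error. -/

section Gram

variable {d : ℕ} {lam : ℝ} (A : Finset (Fin d)) (x : ℕ → Vec d) (n : ℕ)

theorem gram_succ (lam : ℝ) : gram lam A x (n + 1) =
    gram lam A x n + Matrix.vecMulVec (restrict A (x n)) (restrict A (x n)) := by
  simp [gram, Finset.sum_range_succ, add_assoc]

theorem gram_zero (lam : ℝ) : gram lam A x 0 = lam • 1 := by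
  simp [gram]

theorem gram_posDef (hl : 0 < lam) : (gram lam A x n).PosDef := by
  induction n with
  | zero => rw [gram_zero]; exact Matrix.PosDef.one.smul hl
  | succ n ih => rw [gram_succ]; exact posDef_add_vecMulVec_self ih _

theorem restrict_dotProduct_self_le (v : Vec d) : restrict A v ⬝ᵥ restrict A v ≤ ‖v‖ ^ 2 := by
  rw [EuclideanSpace.real_norm_sq_eq, dotProduct]
  refine Finset.sum_le_sum fun i _ => ?_
  unfold restrict
  split_ifs
  · rw [sq]
  · simpa using sq_nonneg _

theorem gram_posSemidef_sum :
    (∑ m ∈ Finset.range n, Matrix.vecMulVec (restrict A (x m)) (restrict A (x m))).PosSemidef := by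
  refine Matrix.posSemidef_sum _ fun m _ => ?_
  have h := Matrix.posSemidef_vecMulVec_self_star (restrict A (x m))
  rwa [star_trivial] at h

theorem gram_det_le (hl : 0 < lam) {L : ℝ} (hx : ∀ m, ‖x m‖ ≤ L) :
    (gram lam A x n).det ≤ lam ^ d * (1 + n * L ^ 2 / lam) ^ A.card := by
  have h := det_smul_one_add_le (gram_posSemidef_sum A x n) hl (t := n * L ^ 2) (r := A.card) ?_ ?_
  · simpa [gram] using h
  · rw [Matrix.trace_sum]
    calc _ ≤ ∑ m ∈ Finset.range n, L ^ 2 := by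
          refine Finset.sum_le_sum fun m _ => ?_
          rw [Matrix.trace_vecMulVec]
          exact (restrict_dotProduct_self_le A (x m)).trans
            (pow_le_pow_left₀ (norm_nonneg _) (hx m) 2)
      _ = _ := by simp
  -- The sum is unchanged by the coordinate projection onto `A`, so its rank is at most `|A|`.
  · have hB : (∑ m ∈ Finset.range n, Matrix.vecMulVec (restrict A (x m)) (restrict A (x m))) =
        Matrix.diagonal (fun i => if i ∈ A then (1 : ℝ) else 0) *
        ∑ m ∈ Finset.range n, Matrix.vecMulVec (restrict A (x m)) (restrict A (x m)) := by
      rw [Finset.mul_sum]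
      refine Finset.sum_congr rfl fun m _ => ?_
      ext i j
      simp only [Matrix.diagonal_mul, Matrix.vecMulVec_apply, restrict]
      split_ifs <;> simp
    rw [hB]
    refine (Matrix.rank_mul_le_left _ _).trans ?_
    rw [Matrix.rank_diagonal, Fintype.card_subtype]
    refine (Finset.card_le_card fun i => ?_)
    simp

theorem gram_quadForm (lam : ℝ) (v : Fin d → ℝ) :
    v ⬝ᵥ (gram lam A x n *ᵥ v) =
      lam * (v ⬝ᵥ v) + ∑ m ∈ Finset.range n, (restrict A (x m) ⬝ᵥ v) ^ 2 := by
  induction n with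
  | zero => simp [gram_zero, Matrix.smul_mulVec]
  | succ n ih =>
    rw [gram_succ, Matrix.add_mulVec, dotProduct_add, ih, vecMulVec_mulVec', dotProduct_smul,
      Finset.sum_range_succ, dotProduct_comm v (restrict A (x n))]
    simp only [smul_eq_mul]
    ring

theorem le_gram_quadForm (lam : ℝ) (v : Fin d → ℝ) :
    lam * (v ⬝ᵥ v) ≤ v ⬝ᵥ (gram lam A x n *ᵥ v) := by
  rw [gram_quadForm]
  exact le_add_of_nonneg_right (Finset.sum_nonneg fun _ _ => sq_nonneg _)

theorem gram_inv_quadForm_nonneg (hl : 0 < lam) (u : Fin d → ℝ) :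
    0 ≤ u ⬝ᵥ ((gram lam A x n)⁻¹ *ᵥ u) := quadForm_nonneg (gram_posDef A x n hl).inv u

theorem gram_det_succ (hl : 0 < lam) : (gram lam A x (n + 1)).det = (gram lam A x n).det *
    (1 + restrict A (x n) ⬝ᵥ ((gram lam A x n)⁻¹ *ᵥ restrict A (x n))) := by
  rw [gram_succ, det_add_vecMulVec_self (gram_posDef A x n hl)]

theorem restrict_dotProduct_of_support {A : Finset (Fin d)} (v : Vec d) {u : Fin d → ℝ}
    (hu : ∀ i, i ∉ A → u i = 0) : restrict A v ⬝ᵥ u = v.ofLp ⬝ᵥ u := by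
  refine Finset.sum_congr rfl fun i _ => ?_
  unfold restrict
  split_ifs with h
  · rfl
  · rw [hu i h]; simp

theorem inner_eq_dotProduct (u v : Vec d) : inner ℝ u v = u.ofLp ⬝ᵥ v.ofLp := by
  rw [EuclideanSpace.inner_eq_star_dotProduct, star_trivial, dotProduct_comm]

/-- Since `log (1 + w) ≥ w / (1 + w)`, it suffices to bound the denominator by `2` for `w ≤ 1`, and
the right side below by `1/2` for `w ≥ 1`. -/
theorem min_one_le_two_mul_log {w : ℝ} (hw : 0 ≤ w) : min 1 w ≤ 2 * Real.log (1 + w) := by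
  have h1 : 0 < 1 + w := by linarith
  have h := Real.one_sub_inv_le_log_of_pos h1
  rcases le_total w 1 with h2 | h2
  · rw [min_eq_right h2]
    have : w / 2 ≤ 1 - (1 + w)⁻¹ := by
      have : 1 - (1 + w)⁻¹ = w / (1 + w) := by field_simp; ring
      rw [this]
      exact div_le_div_of_nonneg_left hw h1 (by linarith)
    linarith
  · rw [min_eq_left h2]
    have : (1 + w)⁻¹ ≤ 2⁻¹ := inv_anti₀ (by norm_num) (by linarith)
    norm_num at this ⊢
    linarith

/-- The elliptic potential lemma. -/
theorem sum_min_one_le (hl : 0 < lam) {L : ℝ} (hx : ∀ m, ‖x m‖ ≤ L) :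
    ∑ m ∈ Finset.range n, min 1 (restrict A (x m) ⬝ᵥ ((gram lam A x m)⁻¹ *ᵥ restrict A (x m))) ≤
      2 * (A.card * Real.log (1 + n * L ^ 2 / lam)) := by
  -- Each round multiplies the determinant by `1 + w`, so the sum of the `log (1 + w)` telescopes.
  have key : ∑ m ∈ Finset.range n,
      min 1 (restrict A (x m) ⬝ᵥ ((gram lam A x m)⁻¹ *ᵥ restrict A (x m))) ≤
      2 * (Real.log (gram lam A x n).det - Real.log (lam ^ d)) := by
    induction n with
    | zero => simp [gram_zero]
    | succ n ih =>
      have hw := gram_inv_quadForm_nonneg A x n hl (restrict A (x n))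
      rw [Finset.sum_range_succ, gram_det_succ A x n hl, Real.log_mul
        (gram_posDef A x n hl).det_pos.ne' (by positivity)]
      have := min_one_le_two_mul_log hw
      linarith
  have h1 : Real.log (gram lam A x n).det ≤
      Real.log (lam ^ d) + A.card * Real.log (1 + n * L ^ 2 / lam) := by
    have hpos : 0 < 1 + n * L ^ 2 / lam := by positivity
    rw [← Real.log_pow, ← Real.log_mul (by positivity) (by positivity)]
    exact Real.log_le_log (gram_posDef A x n hl).det_pos (gram_det_le A x n hl hx)
  linarith

/-- The signed noise accumulated in the directions of the restricted actions. -/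
def noiseSum (A : Finset (Fin d)) (x : ℕ → Vec d) (z : ℕ → ℝ) (n : ℕ) : Fin d → ℝ :=
  ∑ m ∈ Finset.range n, z m • restrict A (x m)

theorem noiseSum_succ (z : ℕ → ℝ) :
    noiseSum A x z (n + 1) = noiseSum A x z n + z n • restrict A (x n) := by
  simp [noiseSum, Finset.sum_range_succ]

theorem gram_mulVec (lam : ℝ) (v : Fin d → ℝ) : gram lam A x n *ᵥ v =
    lam • v + ∑ m ∈ Finset.range n, (restrict A (x m) ⬝ᵥ v) • restrict A (x m) := by
  rw [gram, Matrix.add_mulVec, Matrix.smul_mulVec, Matrix.one_mulVec, Matrix.sum_mulVec]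
  simp_rw [vecMulVec_mulVec']

variable {A} in
/-- A bound on the self-normalized noise puts the true parameter into the confidence ellipsoid. -/
theorem mem_confidenceSet {S L R c : ℝ} (hl : 0 < lam) (hR : 0 ≤ R) {θ : Vec d}
    {y z : ℕ → ℝ} (hθ : ‖θ‖ ≤ S) (hA : ∀ i, i ∉ A → θ i = 0)
    (hy : ∀ m, y m = inner ℝ (x m) θ + R * z m)
    (hz : noiseSum A x z n ⬝ᵥ ((gram lam A x n)⁻¹ *ᵥ noiseSum A x z n) ≤
      A.card * Real.log ((1 + n * L ^ 2 / lam) / c)) :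
    θ ∈ confidenceSet S L R lam c A x y n := by
  have hV := gram_posDef A x n hl
  refine ⟨hA, ?_⟩
  -- Since `θ` vanishes off `A`, the estimation error splits into a noise part and the ridge bias
  -- `-λ V⁻¹θ`; they produce the two terms of the radius.
  have hsum : ∑ m ∈ Finset.range n, y m • restrict A (x m) =
      gram lam A x n *ᵥ θ.ofLp + (R • noiseSum A x z n - lam • θ.ofLp) := by
    rw [gram_mulVec, noiseSum, Finset.smul_sum, add_comm (lam • θ.ofLp), add_assoc,
      add_sub_cancel, ← Finset.sum_add_distrib]
    refine Finset.sum_congr rfl fun m _ => ?_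
    rw [hy m, inner_eq_dotProduct, restrict_dotProduct_of_support (x m) hA, add_smul, smul_smul]
  have hdiff : ridge lam A x y n - θ.ofLp =
      R • ((gram lam A x n)⁻¹ *ᵥ noiseSum A x z n) + -(lam • ((gram lam A x n)⁻¹ *ᵥ θ.ofLp)) := by
    rw [ridge, hsum, Matrix.mulVec_add, inv_mulVec_cancel hV, Matrix.mulVec_sub,
      Matrix.mulVec_smul, Matrix.mulVec_smul]
    abel
  have hq : ∀ (r : ℝ) (u : Fin d → ℝ), (r • ((gram lam A x n)⁻¹ *ᵥ u)) ⬝ᵥ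
      (gram lam A x n *ᵥ (r • ((gram lam A x n)⁻¹ *ᵥ u))) =
        r ^ 2 * (u ⬝ᵥ ((gram lam A x n)⁻¹ *ᵥ u)) := by
    intro r u
    rw [Matrix.mulVec_smul, mulVec_inv_cancel hV, dotProduct_smul, smul_dotProduct,
      dotProduct_comm _ u]
    simp only [smul_eq_mul]; ring
  rw [hdiff]
  refine (sqrt_quadForm_add_le hV _ _).trans ?_
  rw [quadForm_neg, hq, hq]
  unfold radius
  have hS : 0 ≤ S := (norm_nonneg _).trans hθ
  gcongr
  · rw [Real.sqrt_mul (sq_nonneg R), Real.sqrt_sq hR]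
    gcongr
  · have h1 := inv_quadForm_le hV hl (le_gram_quadForm A x n lam) θ.ofLp
    have h2 : θ.ofLp ⬝ᵥ θ.ofLp ≤ S ^ 2 := by
      rw [← inner_eq_dotProduct, real_inner_self_eq_norm_sq]
      exact pow_le_pow_left₀ (norm_nonneg _) hθ 2
    rw [Real.sqrt_le_left (by positivity), mul_pow, Real.sq_sqrt hl.le]
    nlinarith

end Gram

/-! ### Supermartingale inequalities and the Gaussian mixture of sub-Gaussian exponentials. -/

section MeasureTools

open ProbabilityTheory Filter

variable {Ω : Type*} {m mΩ : MeasurableSpace Ω} {μ : Measure Ω}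

/-- Ville's maximal inequality for nonnegative supermartingales. -/
theorem mul_measure_exists_ge_le (ℱ : Filtration ℕ mΩ) {D : ℕ → Ω → ENNReal}
    (hD : ∀ n, Measurable[ℱ n] (D n))
    (hstep : ∀ n s, MeasurableSet[ℱ n] s → ∫⁻ ω in s, D (n + 1) ω ∂μ ≤ ∫⁻ ω in s, D n ω ∂μ)
    (K : ENNReal) : K * μ {ω | ∃ n, K ≤ D n ω} ≤ ∫⁻ ω, D 0 ω ∂μ := by
  -- No crossing of level `K` before time `n`. The event `G (n + 1)` is `ℱ n`-measurable, so the
  -- supermartingale step may be restricted to it.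
  let G : ℕ → Set Ω := fun n => {ω | ∀ i < n, D i ω < K}
  have hG : ∀ n, MeasurableSet[ℱ n] (G (n + 1)) := by
    intro n
    have : G (n + 1) = ⋂ i : Fin (n + 1), {ω | D i ω < K} := by
      ext ω
      simp only [G, Set.mem_ofPred_eq, Set.mem_iInter]
      exact ⟨fun h i => h i i.2, fun h i hi => h ⟨i, hi⟩⟩
    rw [this]
    refine MeasurableSet.iInter fun i => ?_
    exact ℱ.mono (Nat.lt_succ_iff.1 i.2) _
      (measurableSet_lt (hD i) measurable_const)
  have hDm : ∀ n, Measurable (D n) := fun n => (hD n).mono (ℱ.le n) le_rfl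
  have hGm : ∀ n, MeasurableSet (G (n + 1)) := fun n => ℱ.le n _ (hG n)
  have hsplit : ∀ n, G n = G (n + 1) ∪ (G n ∩ {ω | K ≤ D n ω}) := by
    intro n
    ext ω
    simp only [G, Set.mem_ofPred_eq, Set.mem_union, Set.mem_inter_iff]
    constructor
    · intro h
      by_cases hk : K ≤ D n ω
      · exact Or.inr ⟨h, hk⟩
      · left
        intro i hi
        rcases Nat.lt_succ_iff_lt_or_eq.1 hi with h' | rfl
        · exact h i h'
        · exact not_le.1 hk
    · rintro (h | h)
      · exact fun i hi => h i (hi.trans (Nat.lt_succ_self n))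
      · exact h.1
  have hG0 : G 0 = Set.univ := by ext; simp [G]
  have hGm' : ∀ n, MeasurableSet (G n) := by
    rintro (_ | n)
    · rw [hG0]; exact MeasurableSet.univ
    · exact hGm n
  have hbad : ∀ n, MeasurableSet (G n ∩ {ω | K ≤ D n ω}) := fun n =>
    (hGm' n).inter (measurableSet_le measurable_const (hDm n))
  have hlevel : ∀ n, ∫⁻ ω in G (n + 1), D n ω ∂μ + K * μ (G n ∩ {ω | K ≤ D n ω}) ≤
      ∫⁻ ω in G n, D n ω ∂μ := by
    intro n
    have hdisj : Disjoint (G (n + 1)) (G n ∩ {ω | K ≤ D n ω}) := by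
      rw [Set.disjoint_left]
      intro ω h1 h2
      exact absurd (h1 n (Nat.lt_succ_self n)) (not_lt.2 h2.2)
    conv_rhs => rw [hsplit n, lintegral_union (hbad n) hdisj]
    gcongr
    rw [← setLIntegral_const]
    exact setLIntegral_mono (hDm n) fun ω h => h.2
  -- The process stopped at its first crossing: surviving mass plus `K` times the probability of
  -- having crossed never exceeds the initial mass.
  have hmain : ∀ n, ∫⁻ ω in G (n + 1), D n ω ∂μ + K * μ (G (n + 1))ᶜ ≤ ∫⁻ ω, D 0 ω ∂μ := by
    intro n
    induction n with
    | zero =>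
      have h := hlevel 0
      have h2 : (G 1)ᶜ = G 0 ∩ {ω | K ≤ D 0 ω} := by
        ext ω; simp [G]
      rw [zero_add, h2]
      refine h.trans ?_
      rw [hG0, setLIntegral_univ]
    | succ n ih =>
      have h := hlevel (n + 1)
      have h2 : (G (n + 1 + 1))ᶜ ⊆ (G (n + 1))ᶜ ∪ (G (n + 1) ∩ {ω | K ≤ D (n + 1) ω}) := by
        intro ω hω
        by_cases h3 : ω ∈ G (n + 1)
        · have := (hsplit (n + 1)) ▸ h3
          rcases this with h4 | h4
          · exact absurd h4 hω
          · exact Or.inr h4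
        · exact Or.inl h3
      calc _ ≤ ∫⁻ ω in G (n + 1 + 1), D (n + 1) ω ∂μ +
            K * (μ (G (n + 1))ᶜ + μ (G (n + 1) ∩ {ω | K ≤ D (n + 1) ω})) := by
            gcongr
            exact (measure_mono h2).trans (measure_union_le _ _)
        _ = (∫⁻ ω in G (n + 1 + 1), D (n + 1) ω ∂μ +
            K * μ (G (n + 1) ∩ {ω | K ≤ D (n + 1) ω})) + K * μ (G (n + 1))ᶜ := by ring
        _ ≤ ∫⁻ ω in G (n + 1), D (n + 1) ω ∂μ + K * μ (G (n + 1))ᶜ := by gcongr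
        _ ≤ ∫⁻ ω in G (n + 1), D n ω ∂μ + K * μ (G (n + 1))ᶜ := by
            exact add_le_add (hstep n _ (hG n)) le_rfl
        _ ≤ _ := ih
  have hU : {ω | ∃ n, K ≤ D n ω} = ⋃ n, (G (n + 1))ᶜ := by
    ext ω
    simp only [G, Set.mem_ofPred_eq, Set.mem_iUnion, Set.mem_compl_iff, not_forall, not_lt]
    constructor
    · rintro ⟨n, h⟩
      exact ⟨n, n, Nat.lt_succ_self n, h⟩
    · rintro ⟨n, i, _, h⟩
      exact ⟨i, h⟩
  have hmono : Monotone fun n => (G (n + 1))ᶜ := by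
    intro i j hij
    refine Set.compl_subset_compl.2 fun ω h l hl => h l (by omega)
  rw [hU, hmono.measure_iUnion, ENNReal.mul_iSup]
  exact iSup_le fun n => le_add_self.trans (hmain n)

variable [IsProbabilityMeasure μ]

/-- A bound on a conditional expectation, tested against a nonnegative measurable weight. -/
theorem lintegral_mul_le_of_condExp_le (hm : m ≤ mΩ) {f g : Ω → ℝ} (hf : Integrable f μ)
    (hf0 : 0 ≤ f) (hfg : condExp m μ f ≤ᵐ[μ] g) {Z : Ω → ENNReal} (hZ : Measurable[m] Z) :
    ∫⁻ ω, Z ω * ENNReal.ofReal (f ω) ∂μ ≤ ∫⁻ ω, Z ω * ENNReal.ofReal (g ω) ∂μ := by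
  have hc0 : 0 ≤ᵐ[μ] condExp m μ f := condExp_nonneg (ae_of_all _ hf0)
  have hc : Integrable (condExp m μ f) μ := integrable_condExp
  have hset : ∀ s, MeasurableSet[m] s →
      ∫⁻ ω in s, ENNReal.ofReal (f ω) ∂μ = ∫⁻ ω in s, ENNReal.ofReal (condExp m μ f ω) ∂μ := by
    intro s hs
    rw [← ofReal_integral_eq_lintegral_ofReal hf.integrableOn (ae_of_all _ hf0),
      ← ofReal_integral_eq_lintegral_ofReal hc.integrableOn (ae_restrict_of_ae hc0),
      setIntegral_condExp hm hf hs]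
  -- The densities `f` and `condExp m μ f` define the same measure on `m`, so any `m`-measurable
  -- weight can be tested, without an integrability condition.
  have htrim : (μ.withDensity fun ω => ENNReal.ofReal (f ω)).trim hm =
      (μ.withDensity fun ω => ENNReal.ofReal (condExp m μ f ω)).trim hm := by
    refine @Measure.ext _ m _ _ fun s hs => ?_
    rw [trim_measurableSet_eq hm hs, trim_measurableSet_eq hm hs,
      withDensity_apply _ (hm s hs), withDensity_apply _ (hm s hs), hset s hs]
  have hkey : ∀ h : Ω → ℝ, AEMeasurable h μ → ∫⁻ ω, Z ω * ENNReal.ofReal (h ω) ∂μ =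
      ∫⁻ ω, Z ω ∂((μ.withDensity fun ω => ENNReal.ofReal (h ω)).trim hm) := by
    intro h hh
    rw [lintegral_trim hm hZ, lintegral_withDensity_eq_lintegral_mul₀' hh.ennreal_ofReal
      (hZ.mono hm le_rfl).aemeasurable]
    simp [mul_comm]
  rw [hkey f hf.1.aemeasurable, htrim, ← hkey _ hc.1.aemeasurable]
  refine lintegral_mono_ae ?_
  filter_upwards [hfg] with ω h
  gcongr

variable {X : Ω → ℝ}

theorem lintegral_mul_exp_const_le (hm : m ≤ mΩ)
    (hint : ∀ s : ℝ, Integrable (fun ω => Real.exp (s * X ω)) μ)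
    (hsub : ∀ s : ℝ, condExp m μ (fun ω => Real.exp (s * X ω)) ≤ᵐ[μ]
      fun _ => Real.exp (s ^ 2 / 2)) (s : ℝ) {Z : Ω → ENNReal} (hZ : Measurable[m] Z) :
    ∫⁻ ω, Z ω * ENNReal.ofReal (Real.exp (s * X ω - s ^ 2 / 2)) ∂μ ≤ ∫⁻ ω, Z ω ∂μ := by
  have h := lintegral_mul_le_of_condExp_le hm (hint s) (fun ω => (Real.exp_pos _).le) (hsub s)
    (hZ.mul_const (ENNReal.ofReal (Real.exp (-(s ^ 2 / 2)))))
  have h1 : ∀ u : ℝ, ∀ z : ENNReal, z * ENNReal.ofReal (Real.exp (-(s ^ 2 / 2))) *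
      ENNReal.ofReal (Real.exp u) = z * ENNReal.ofReal (Real.exp (u - s ^ 2 / 2)) := by
    intro u z
    rw [mul_assoc, ← ENNReal.ofReal_mul (Real.exp_pos _).le, ← Real.exp_add]
    congr 3
    ring
  simp_rw [h1] at h
  simpa using h

/-- On each fibre of `U` the exponent is a constant, and the indicator of the fibre is absorbed into
the weight `Z`. -/
theorem lintegral_mul_exp_finite_range_le (hm : m ≤ mΩ) (hX : Measurable[mΩ] X)
    (hint : ∀ s : ℝ, Integrable (fun ω => Real.exp (s * X ω)) μ)
    (hsub : ∀ s : ℝ, condExp m μ (fun ω => Real.exp (s * X ω)) ≤ᵐ[μ]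
      fun _ => Real.exp (s ^ 2 / 2)) {U : Ω → ℝ} (hU : Measurable[m] U) (hfin : (Set.range U).Finite)
    {Z : Ω → ENNReal} (hZ : Measurable[m] Z) :
    ∫⁻ ω, Z ω * ENNReal.ofReal (Real.exp (U ω * X ω - U ω ^ 2 / 2)) ∂μ ≤ ∫⁻ ω, Z ω ∂μ := by
  classical
  have hfib : ∀ s, MeasurableSet[m] (U ⁻¹' {s}) := fun s => hU (measurableSet_singleton s)
  have hZs : ∀ s, Measurable[m] ((U ⁻¹' {s}).indicator Z) := fun s => hZ.indicator (hfib s)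
  have hsplit : ∀ g : ℝ → Ω → ENNReal, ∀ ω, Z ω * g (U ω) ω =
      ∑ s ∈ hfin.toFinset, (U ⁻¹' {s}).indicator Z ω * g s ω := by
    intro g ω
    rw [Finset.sum_eq_single (U ω)]
    · simp
    · intro s _ hs
      rw [Set.indicator_of_notMem (by simpa using hs.symm), zero_mul]
    · intro h
      exact absurd (hfin.mem_toFinset.2 ⟨ω, rfl⟩) h
  have h1 : ∀ ω, Z ω = ∑ s ∈ hfin.toFinset, (U ⁻¹' {s}).indicator Z ω := by
    intro ω
    simpa using hsplit (fun _ _ => 1) ω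
  have h2 := hsplit fun s ω => ENNReal.ofReal (Real.exp (s * X ω - s ^ 2 / 2))
  have hmeas : ∀ s ∈ hfin.toFinset, Measurable fun ω => (U ⁻¹' {s}).indicator Z ω *
      ENNReal.ofReal (Real.exp (s * X ω - s ^ 2 / 2)) := fun s _ =>
    ((hZs s).mono hm le_rfl).mul (by fun_prop)
  simp_rw [h2]
  rw [lintegral_congr h1, lintegral_finsetSum _ fun s _ => (hZs s).mono hm le_rfl,
    lintegral_finsetSum _ hmeas]
  exact Finset.sum_le_sum fun s _ => lintegral_mul_exp_const_le hm hint hsub s (hZs s)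

/-- Conditional sub-Gaussianity with an exponent known in advance. -/
theorem lintegral_mul_exp_le (hm : m ≤ mΩ) (hX : Measurable[mΩ] X)
    (hint : ∀ s : ℝ, Integrable (fun ω => Real.exp (s * X ω)) μ)
    (hsub : ∀ s : ℝ, condExp m μ (fun ω => Real.exp (s * X ω)) ≤ᵐ[μ]
      fun _ => Real.exp (s ^ 2 / 2)) {U : Ω → ℝ} (hU : Measurable[m] U)
    {Z : Ω → ENNReal} (hZ : Measurable[m] Z) (hZt : ∀ ω, Z ω ≠ ⊤) :
    ∫⁻ ω, Z ω * ENNReal.ofReal (Real.exp (U ω * X ω - U ω ^ 2 / 2)) ∂μ ≤ ∫⁻ ω, Z ω ∂μ := by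
  -- Simple `m`-measurable approximations of `U` reduce to finite range; Fatou's lemma passes to the
  -- limit.
  have hUs : StronglyMeasurable[m] U := hU.stronglyMeasurable
  have hlim : ∀ ω, Tendsto (fun n => Z ω * ENNReal.ofReal
      (Real.exp (hUs.approx n ω * X ω - hUs.approx n ω ^ 2 / 2))) atTop
      (nhds (Z ω * ENNReal.ofReal (Real.exp (U ω * X ω - U ω ^ 2 / 2)))) := by
    intro ω
    refine ENNReal.Tendsto.const_mul ?_ (Or.inr (hZt ω))
    refine ENNReal.tendsto_ofReal ((Real.continuous_exp.tendsto _).comp ?_)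
    have h := hUs.tendsto_approx ω
    exact (h.mul_const _).sub ((h.pow 2).div_const 2)
  calc ∫⁻ ω, Z ω * ENNReal.ofReal (Real.exp (U ω * X ω - U ω ^ 2 / 2)) ∂μ
      = ∫⁻ ω, liminf (fun n => Z ω * ENNReal.ofReal
          (Real.exp (hUs.approx n ω * X ω - hUs.approx n ω ^ 2 / 2))) atTop ∂μ :=
        lintegral_congr fun ω => ((hlim ω).liminf_eq).symm
    _ ≤ liminf (fun n => ∫⁻ ω, Z ω * ENNReal.ofReal
          (Real.exp (hUs.approx n ω * X ω - hUs.approx n ω ^ 2 / 2)) ∂μ) atTop := by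
        refine lintegral_liminf_le fun n => ?_
        have h : Measurable[mΩ] (hUs.approx n) :=
          (@SimpleFunc.measurable _ _ m _ (hUs.approx n)).mono hm le_rfl
        exact (hZ.mono hm le_rfl).mul (by fun_prop)
    _ ≤ liminf (fun _ : ℕ => ∫⁻ ω, Z ω ∂μ) atTop :=
        liminf_le_liminf (Eventually.of_forall fun n =>
          lintegral_mul_exp_finite_range_le hm hX hint hsub
            (@SimpleFunc.measurable _ _ m _ (hUs.approx n)) (@SimpleFunc.finite_range _ _ m (hUs.approx n)) hZ)
    _ = ∫⁻ ω, Z ω ∂μ := by simp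

/-- The likelihood ratio of one observation, mixed over a Gaussian prior. -/
noncomputable def mixRatio (a w X : ℝ) : ℝ :=
  (Real.sqrt (1 + w))⁻¹ * Real.exp ((2 * X * a + X ^ 2 * w - a ^ 2) / (2 * (1 + w)))

/-- Under the Gaussian mixture the current posterior of the parameter is `N(V⁻¹s, V⁻¹)`, so its
component along the next direction `u` is `N(a, w)` with `a = u ⬝ᵥ V⁻¹s` and `w = u ⬝ᵥ V⁻¹u`. One
step of the mixture is therefore a one-dimensional integral, computed by completing the square; the
variance becomes `1 / (1 + w)`. -/
theorem lintegral_gaussian_mixture (a X : ℝ) {w : ℝ} (hw : 0 ≤ w) :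
    ∫⁻ z, ENNReal.ofReal (gaussianPDFReal 0 1 z) * ENNReal.ofReal
      (Real.exp ((a + Real.sqrt w * z) * X - (a + Real.sqrt w * z) ^ 2 / 2)) =
    ENNReal.ofReal (mixRatio a w X) := by
  have h1 : 0 < 1 + w := by linarith
  let v : NNReal := ⟨(1 + w)⁻¹, by positivity⟩
  have hv : v ≠ 0 := by
    intro h
    have := congrArg NNReal.toReal h
    simp only [v, NNReal.coe_zero] at this
    exact (inv_pos.2 h1).ne' this
  have hvr : (v : ℝ) = (1 + w)⁻¹ := rfl
  have hK : 0 ≤ mixRatio a w X := by unfold mixRatio; positivity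
  have key : ∀ z, gaussianPDFReal 0 1 z *
      Real.exp ((a + Real.sqrt w * z) * X - (a + Real.sqrt w * z) ^ 2 / 2) =
      mixRatio a w X * gaussianPDFReal (Real.sqrt w * (X - a) / (1 + w)) v z := by
    intro z
    have hs : Real.sqrt w ^ 2 = w := Real.sq_sqrt hw
    have h2 : (Real.sqrt (2 * Real.pi * v))⁻¹ =
        (Real.sqrt (2 * Real.pi))⁻¹ * Real.sqrt (1 + w) := by
      rw [hvr, Real.sqrt_mul (by positivity), Real.sqrt_inv, mul_inv, inv_inv]
    simp only [gaussianPDFReal, mixRatio]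
    rw [h2, hvr]
    have h3 : Real.sqrt (1 + w) ≠ 0 := by positivity
    have h4 : ∀ p q r s : ℝ, (Real.sqrt (1 + w))⁻¹ * p * (q * Real.sqrt (1 + w) * r) =
      q * (p * r) := by intro p q r s; field_simp
    rw [h4 _ _ _ 0, ← Real.exp_add, mul_assoc, ← Real.exp_add]
    simp only [NNReal.coe_one, mul_one, sub_zero]
    congr 2
    field_simp
    have hz : ∀ t : ℝ, t ^ 2 = w → -z ^ 2 + ((a + t * z) * X * 2 - (a + t * z) ^ 2) -
      ((2 * X * a + X ^ 2 * w - a ^ 2) - (z * (1 + w) - t * (X - a)) ^ 2) / (1 + w) = 0 := by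
      intro t ht
      subst ht
      field_simp
      ring
    have := hz _ hs
    field_simp at this
    linear_combination this
  simp_rw [← ENNReal.ofReal_mul (gaussianPDFReal_nonneg _ _ _), key, ENNReal.ofReal_mul hK]
  rw [lintegral_const_mul _ (by fun_prop), lintegral_gaussianPDFReal_eq_one _ hv, mul_one]

/-- By Tonelli the Gaussian variable `z` may be fixed first; then `a + √w z` is an exponent known in
advance. -/
theorem lintegral_mul_mixRatio_le (hm : m ≤ mΩ) (hX : Measurable[mΩ] X)
    (hint : ∀ s : ℝ, Integrable (fun ω => Real.exp (s * X ω)) μ)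
    (hsub : ∀ s : ℝ, condExp m μ (fun ω => Real.exp (s * X ω)) ≤ᵐ[μ]
      fun _ => Real.exp (s ^ 2 / 2)) {a w : Ω → ℝ} (ha : Measurable[m] a) (hw : Measurable[m] w)
    (hw0 : ∀ ω, 0 ≤ w ω) {Z : Ω → ENNReal} (hZ : Measurable[m] Z) (hZt : ∀ ω, Z ω ≠ ⊤) :
    ∫⁻ ω, Z ω * ENNReal.ofReal (mixRatio (a ω) (w ω) (X ω)) ∂μ ≤ ∫⁻ ω, Z ω ∂μ := by
  have ha' := ha.mono hm le_rfl
  have hw' := hw.mono hm le_rfl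
  have hZ' := hZ.mono hm le_rfl
  calc ∫⁻ ω, Z ω * ENNReal.ofReal (mixRatio (a ω) (w ω) (X ω)) ∂μ
      = ∫⁻ ω, (∫⁻ z : ℝ, ENNReal.ofReal (gaussianPDFReal 0 1 z) * (Z ω * ENNReal.ofReal
          (Real.exp ((a ω + Real.sqrt (w ω) * z) * X ω - (a ω + Real.sqrt (w ω) * z) ^ 2 / 2))))
          ∂μ := by
        refine lintegral_congr fun ω => ?_
        rw [← lintegral_gaussian_mixture _ _ (hw0 ω), ← lintegral_const_mul _ (by fun_prop)]
        exact lintegral_congr fun z => by ring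
    _ = ∫⁻ z, ∫⁻ ω, ENNReal.ofReal (gaussianPDFReal 0 1 z) * (Z ω * ENNReal.ofReal
          (Real.exp ((a ω + Real.sqrt (w ω) * z) * X ω - (a ω + Real.sqrt (w ω) * z) ^ 2 / 2)))
          ∂μ := by
        refine lintegral_lintegral_swap (Measurable.aemeasurable ?_)
        simp only [Function.uncurry_def]
        fun_prop
    _ = ∫⁻ z, ENNReal.ofReal (gaussianPDFReal 0 1 z) * ∫⁻ ω, Z ω * ENNReal.ofReal
          (Real.exp ((a ω + Real.sqrt (w ω) * z) * X ω - (a ω + Real.sqrt (w ω) * z) ^ 2 / 2))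
          ∂μ := by
        refine lintegral_congr fun z => lintegral_const_mul _ ?_
        fun_prop
    _ ≤ ∫⁻ z, ENNReal.ofReal (gaussianPDFReal 0 1 z) * ∫⁻ ω, Z ω ∂μ := by
        refine lintegral_mono fun z => ?_
        refine mul_le_mul_right (lintegral_mul_exp_le hm hX hint hsub ?_ hZ hZt) _
        exact ha.add (hw.sqrt.mul_const z)
    _ = ∫⁻ ω, Z ω ∂μ := by
        rw [lintegral_mul_const _ (by fun_prop), lintegral_gaussianPDFReal_eq_one _ one_ne_zero,
          one_mul]

end MeasureTools

/-! ### Measurability of determinants, inverses and Gram matrices. -/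

section Measurability

variable {Ω : Type*} {m : MeasurableSpace Ω} {ι : Type*} [Fintype ι] [DecidableEq ι]

theorem measurable_matrix_det {V : Ω → Matrix ι ι ℝ}
    (hV : ∀ i j, Measurable[m] fun ω => V ω i j) : Measurable[m] fun ω => (V ω).det := by
  simp_rw [Matrix.det_apply]
  exact Finset.measurable_sum _ fun σ _ =>
    (Finset.measurable_prod _ fun i _ => hV (σ i) i).const_smul _

theorem measurable_matrix_inv {V : Ω → Matrix ι ι ℝ}
    (hV : ∀ i j, Measurable[m] fun ω => V ω i j) (i j : ι) :
    Measurable[m] fun ω => (V ω)⁻¹ i j := by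
  simp_rw [Matrix.inv_def, Matrix.smul_apply, Ring.inverse_eq_inv', smul_eq_mul,
    Matrix.adjugate_apply]
  refine (measurable_matrix_det hV).inv.mul (measurable_matrix_det fun k l => ?_)
  simp_rw [Matrix.updateRow_apply]
  split_ifs
  · exact measurable_const
  · exact hV k l

omit [DecidableEq ι] in
theorem measurable_bilinForm {V : Ω → Matrix ι ι ℝ} {u v : Ω → ι → ℝ}
    (hV : ∀ i j, Measurable[m] fun ω => V ω i j) (hu : ∀ i, Measurable[m] fun ω => u ω i)
    (hv : ∀ i, Measurable[m] fun ω => v ω i) :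
    Measurable[m] fun ω => u ω ⬝ᵥ (V ω *ᵥ v ω) := by
  simp only [dotProduct, Matrix.mulVec]
  exact Finset.measurable_sum _ fun i _ => (hu i).mul
    (Finset.measurable_sum _ fun j _ => (hV i j).mul (hv j))

theorem measurable_restrict {d : ℕ} {X : Ω → Vec d} (hX : Measurable[m] X) (A : Finset (Fin d))
    (i : Fin d) : Measurable[m] fun ω => restrict A (X ω) i := by
  unfold restrict
  split_ifs
  · exact (measurable_pi_apply i).comp ((WithLp.measurable_ofLp _ _).comp hX)
  · exact measurable_const

theorem measurable_gram {d n : ℕ} {X : ℕ → Ω → Vec d} (hX : ∀ k < n, Measurable[m] (X k))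
    (lam : ℝ) (A : Finset (Fin d)) (i j : Fin d) :
    Measurable[m] fun ω => gram lam A (fun k => X k ω) n i j := by
  unfold gram
  simp only [Matrix.add_apply, Matrix.sum_apply, Matrix.vecMulVec_apply]
  exact measurable_const.add (Finset.measurable_sum _ fun k hk =>
    (measurable_restrict (hX k (Finset.mem_range.1 hk)) A i).mul
      (measurable_restrict (hX k (Finset.mem_range.1 hk)) A j))

theorem measurable_noiseSum {d n : ℕ} {X : ℕ → Ω → Vec d} {z : ℕ → Ω → ℝ}
    (hX : ∀ k < n, Measurable[m] (X k)) (hz : ∀ k < n, Measurable[m] (z k))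
    (A : Finset (Fin d)) (i : Fin d) :
    Measurable[m] fun ω => noiseSum A (fun k => X k ω) (fun k => z k ω) n i := by
  unfold noiseSum
  simp only [Finset.sum_apply, Pi.smul_apply, smul_eq_mul]
  exact Finset.measurable_sum _ fun k hk => (hz k (Finset.mem_range.1 hk)).mul
    (measurable_restrict (hX k (Finset.mem_range.1 hk)) A i)

end Measurability

/-! ### The self-normalized mixture process along a path. -/

section SelfNormalized

variable {d : ℕ} {lam : ℝ} (A : Finset (Fin d)) (x : ℕ → Vec d) (z : ℕ → ℝ) (n : ℕ)

/-- The self-normalized quadratic form of the noise. -/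
noncomputable def noiseForm (lam : ℝ) (A : Finset (Fin d)) (x : ℕ → Vec d) (z : ℕ → ℝ) (n : ℕ) :
    ℝ :=
  noiseSum A x z n ⬝ᵥ ((gram lam A x n)⁻¹ *ᵥ noiseSum A x z n)

/-- The Gaussian mixture of the exponential supermartingales of the noise. -/
noncomputable def mixture (lam : ℝ) (A : Finset (Fin d)) (x : ℕ → Vec d) (z : ℕ → ℝ) (n : ℕ) : ℝ :=
  Real.sqrt (lam ^ d / (gram lam A x n).det) * Real.exp (noiseForm lam A x z n / 2)

theorem mixture_zero (hl : 0 < lam) : mixture lam A x z 0 = 1 := by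
  have h : lam ^ d ≠ 0 := by positivity
  simp [mixture, noiseForm, noiseSum, gram_zero, h]

theorem mixture_nonneg : 0 ≤ mixture lam A x z n := by
  unfold mixture; positivity

/-- The determinant gains the factor `1 + w`, which yields the prefactor of `mixRatio`; the rank-one
update of the quadratic form yields its exponent. -/
theorem mixture_succ (hl : 0 < lam) : mixture lam A x z (n + 1) = mixture lam A x z n *
    mixRatio (restrict A (x n) ⬝ᵥ ((gram lam A x n)⁻¹ *ᵥ noiseSum A x z n))
      (restrict A (x n) ⬝ᵥ ((gram lam A x n)⁻¹ *ᵥ restrict A (x n))) (z n) := by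
  have hdet := (gram_posDef A x n hl).det_pos
  have hw := gram_inv_quadForm_nonneg A x n hl (restrict A (x n))
  unfold mixture mixRatio noiseForm
  rw [gram_det_succ A x n hl, noiseSum_succ, gram_succ,
    inv_quadForm_add_vecMulVec_self (gram_posDef A x n hl), ← div_div, div_eq_mul_inv _ (1 + _),
    Real.sqrt_mul (by positivity), Real.sqrt_inv, add_div, Real.exp_add]
  have h : ∀ p q : ℝ, p / q / 2 = p / (2 * q) := by intro p q; rw [div_div, mul_comm]
  rw [h]
  ring

/-- Below the level `c ^ (-|A| / 2)` of the mixture, the noise is within the confidence radius. -/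
theorem noiseForm_le_of_mixture_lt (hl : 0 < lam) {L c : ℝ} (hc : 0 < c) (hx : ∀ k, ‖x k‖ ≤ L)
    (h : mixture lam A x z n < (Real.sqrt c ^ A.card)⁻¹) :
    noiseForm lam A x z n ≤ A.card * Real.log ((1 + n * L ^ 2 / lam) / c) := by
  have hdet := (gram_posDef A x n hl).det_pos
  have hle := gram_det_le A x n hl hx
  have hb : 0 < 1 + n * L ^ 2 / lam := by positivity
  have h1 : Real.log (gram lam A x n).det ≤
      Real.log (lam ^ d) + A.card * Real.log (1 + n * L ^ 2 / lam) := by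
    rw [← Real.log_pow, ← Real.log_mul (by positivity) (by positivity)]
    exact Real.log_le_log hdet hle
  have hpos : 0 < mixture lam A x z n := by unfold mixture; positivity
  have h2 := Real.log_lt_log hpos h
  rw [mixture, Real.log_mul (by positivity) (by positivity), Real.log_exp, Real.log_sqrt
    (by positivity), Real.log_div (by positivity) hdet.ne', Real.log_inv, Real.log_pow _ A.card,
    Real.log_sqrt hc.le] at h2
  rw [Real.log_div hb.ne' hc.ne', mul_sub]
  linarith

end SelfNormalized

/-! ### Confidence ellipsoids for a fixed feature set. -/

section Confidence

variable {Ω : Type*} [mΩ : MeasurableSpace Ω] {μ : Measure Ω} [IsProbabilityMeasure μ]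

/-- The function `exp X + exp (-X) - 2` is nonnegative, vanishes only at `X = 0` and has integral at
most `0`. This handles `R = 0`, where the rewards are almost surely noiseless. -/
theorem ae_eq_zero_of_exp_le {X : Ω → ℝ}
    (hint : ∀ s : ℝ, Integrable (fun ω => Real.exp (s * X ω)) μ)
    (hle : ∀ s : ℝ, ∫ ω, Real.exp (s * X ω) ∂μ ≤ 1) : ∀ᵐ ω ∂μ, X ω = 0 := by
  have hi : Integrable (fun ω => Real.exp (1 * X ω) + Real.exp (-1 * X ω) - 2) μ :=
    ((hint 1).add (hint (-1))).sub (integrable_const _)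
  have h0 : ∀ u : ℝ, u ≠ 0 → 0 < Real.exp (1 * u) + Real.exp (-1 * u) - 2 := by
    intro u hu
    have h1 := Real.add_one_lt_exp hu
    have h2 := Real.add_one_lt_exp (neg_ne_zero.2 hu)
    rw [one_mul, neg_one_mul]
    linarith
  have hnn : 0 ≤ fun ω => Real.exp (1 * X ω) + Real.exp (-1 * X ω) - 2 := by
    intro ω
    by_cases h : X ω = 0
    · simp only [h]; norm_num
    · exact (h0 _ h).le
  have hz : ∫ ω, (Real.exp (1 * X ω) + Real.exp (-1 * X ω) - 2) ∂μ = 0 := by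
    refine le_antisymm ?_ (integral_nonneg hnn)
    have hadd : ∫ ω, (Real.exp (1 * X ω) + Real.exp (-1 * X ω) - 2) ∂μ =
        ∫ ω, Real.exp (1 * X ω) ∂μ + ∫ ω, Real.exp (-1 * X ω) ∂μ - ∫ _, (2 : ℝ) ∂μ := by
      rw [← integral_add (hint 1) (hint (-1))]
      exact integral_sub ((hint 1).add (hint (-1))) (integrable_const _)
    rw [hadd]
    have := hle 1
    have := hle (-1)
    simp only [integral_const, probReal_univ, smul_eq_mul]
    linarith
  rw [integral_eq_zero_iff_of_nonneg hnn hi] at hz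
  filter_upwards [hz] with ω h
  by_contra hne
  exact (h0 _ hne).ne' h

variable {d : ℕ} {ℱ 𝒢 : Filtration ℕ mΩ} {E : Interaction Ω d} {θ : Vec d} {N : Finset (Fin d)}
  {S L R p : ℝ}

namespace Interaction

/-- The noise of round `n` in units of `R`. -/
noncomputable def noise (E : Interaction Ω d) (θ : Vec d) (R : ℝ) (n : ℕ) (ω : Ω) : ℝ :=
  (E.reward n ω - inner ℝ (E.action n ω) θ) / R

namespace IsFeatureFeedbackModel

theorem measurable_action_of_lt (hM : E.IsFeatureFeedbackModel μ ℱ 𝒢 θ N S L R p) {k n : ℕ}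
    (h : k < n) : Measurable[ℱ n] (E.action k) :=
  (hM.measurable_action k).mono ((hM.le_next k).trans (ℱ.mono h)) le_rfl

theorem measurable_noise_of_lt (hM : E.IsFeatureFeedbackModel μ ℱ 𝒢 θ N S L R p) {k n : ℕ}
    (h : k < n) : Measurable[ℱ n] (E.noise θ R k) := by
  have h1 : Measurable[ℱ n] (E.reward k) :=
    (hM.measurable_reward k).mono (ℱ.mono h) le_rfl
  have h2 : Measurable[ℱ n] fun ω => inner ℝ (E.action k ω) θ :=
    (continuous_id.inner continuous_const).measurable.comp (hM.measurable_action_of_lt h)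
  exact (h1.sub h2).div_const R

theorem exp_noise (s : ℝ) (n : ℕ) : (fun ω => Real.exp (s * E.noise θ R n ω)) =
    fun ω => Real.exp (s / R * (E.reward n ω - inner ℝ (E.action n ω) θ)) := by
  ext ω
  congr 1
  unfold noise
  ring

theorem integrable_exp_noise (hM : E.IsFeatureFeedbackModel μ ℱ 𝒢 θ N S L R p) (n : ℕ) (s : ℝ) :
    Integrable (fun ω => Real.exp (s * E.noise θ R n ω)) μ := by
  rw [exp_noise]
  exact hM.integrable_noise n _

theorem condExp_exp_noise_le (hM : E.IsFeatureFeedbackModel μ ℱ 𝒢 θ N S L R p) (n : ℕ) (s : ℝ) :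
    condExp (𝒢 n) μ (fun ω => Real.exp (s * E.noise θ R n ω)) ≤ᵐ[μ]
      fun _ => Real.exp (s ^ 2 / 2) := by
  rw [exp_noise]
  refine (hM.subgaussian_noise n (s / R)).trans (Filter.Eventually.of_forall fun ω => ?_)
  refine Real.exp_le_exp.2 ?_
  -- For `R = 0` division by zero makes the normalized noise `0`, and the bound is trivial.
  rcases eq_or_ne R 0 with h | h
  · rw [h, div_zero]
    nlinarith [sq_nonneg s]
  · rw [div_pow, div_mul_cancel₀ _ (pow_ne_zero 2 h)]

theorem ae_reward_eq (hM : E.IsFeatureFeedbackModel μ ℱ 𝒢 θ N S L R p) :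
    ∀ᵐ ω ∂μ, ∀ n, E.reward n ω = inner ℝ (E.action n ω) θ + R * E.noise θ R n ω := by
  rw [ae_all_iff]
  intro n
  rcases eq_or_ne R 0 with h | h
  · have h1 := ae_eq_zero_of_exp_le (hM.integrable_noise n) fun s => by
      rw [← integral_condExp (𝒢.le n)]
      refine (integral_mono_ae integrable_condExp (integrable_const _)
        (hM.subgaussian_noise n s)).trans ?_
      simp [h]
    filter_upwards [h1] with ω hω
    rw [h]
    linarith
  · refine ae_of_all _ fun ω => ?_
    unfold noise
    field_simp
    ring

/-- The self-normalized bound: with a fixed feature set that contains all relevant features, the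
confidence ellipsoids of all rounds contain the true parameter with high probability. -/
theorem measure_exists_notMem_confidenceSet_le
    (hM : E.IsFeatureFeedbackModel μ ℱ 𝒢 θ N S L R p)
    (hact : ∀ n ω, E.action n ω ∈ E.actions n ω) {lam c : ℝ} (hl : 0 < lam) (hR : 0 ≤ R)
    (hc : 0 < c) {A : Finset (Fin d)} (hA : supp θ ⊆ A) :
    μ {ω | ∃ n, θ ∉ confidenceSet S L R lam c A (fun k => E.action k ω)
      (fun k => E.reward k ω) n} ≤ ENNReal.ofReal (Real.sqrt c ^ A.card) := by
  let D : ℕ → Ω → ENNReal := fun n ω =>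
    ENNReal.ofReal (mixture lam A (fun k => E.action k ω) (fun k => E.noise θ R k ω) n)
  have hgram : ∀ n i j, Measurable[ℱ n] fun ω => gram lam A (fun k => E.action k ω) n i j :=
    fun n => measurable_gram (fun k hk => hM.measurable_action_of_lt hk) lam A
  have hsum : ∀ n i, Measurable[ℱ n] fun ω =>
      noiseSum A (fun k => E.action k ω) (fun k => E.noise θ R k ω) n i :=
    fun n => measurable_noiseSum (fun k hk => hM.measurable_action_of_lt hk)
      (fun k hk => hM.measurable_noise_of_lt hk) A
  have hD : ∀ n, Measurable[ℱ n] (D n) := by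
    intro n
    refine Measurable.ennreal_ofReal (Measurable.mul ?_ ?_)
    · exact (measurable_const.div (measurable_matrix_det (hgram n))).sqrt
    · exact ((measurable_bilinForm (measurable_matrix_inv (hgram n)) (hsum n) (hsum n)).div_const
        2).exp
  have hstep : ∀ n s, MeasurableSet[ℱ n] s →
      ∫⁻ ω in s, D (n + 1) ω ∂μ ≤ ∫⁻ ω in s, D n ω ∂μ := by
    intro n s hs
    -- The action of round `n` is known only in `𝒢 n`, and the noise is sub-Gaussian given `𝒢 n`;
    -- the step is conditioned there although `D n` is already `ℱ n`-measurable.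
    have hFG := hM.before_le n
    have hs' := ℱ.le n s hs
    have hu : ∀ i, Measurable[𝒢 n] fun ω => restrict A (E.action n ω) i :=
      measurable_restrict (hM.measurable_action n) A
    have hinv : ∀ i j, Measurable[𝒢 n] fun ω =>
        (gram lam A (fun k => E.action k ω) n)⁻¹ i j :=
      fun i j => (measurable_matrix_inv (hgram n) i j).mono hFG le_rfl
    have h := lintegral_mul_mixRatio_le (μ := μ) (𝒢.le n)
      ((hM.measurable_noise_of_lt (Nat.lt_succ_self n)).mono (ℱ.le (n + 1)) le_rfl)
      (hM.integrable_exp_noise n) (hM.condExp_exp_noise_le n)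
      (measurable_bilinForm hinv hu fun i => (hsum n i).mono hFG le_rfl)
      (measurable_bilinForm hinv hu hu)
      (fun ω => gram_inv_quadForm_nonneg A _ n hl _) (Z := s.indicator (D n))
      (((hD n).indicator hs).mono hFG le_rfl)
      (fun ω => by
        by_cases hω : ω ∈ s
        · rw [Set.indicator_of_mem hω]; exact ENNReal.ofReal_ne_top
        · rw [Set.indicator_of_notMem hω]; exact ENNReal.zero_ne_top)
    rw [lintegral_indicator hs'] at h
    refine le_trans (le_of_eq ?_) h
    rw [← lintegral_indicator hs']
    refine lintegral_congr fun ω => ?_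
    by_cases hω : ω ∈ s
    · rw [Set.indicator_of_mem hω, Set.indicator_of_mem hω,
        ← ENNReal.ofReal_mul (mixture_nonneg A _ _ n), ← mixture_succ A _ _ n hl]
    · rw [Set.indicator_of_notMem hω, Set.indicator_of_notMem hω, zero_mul]
  have hK : 0 < Real.sqrt c ^ A.card := by positivity
  -- The level `c ^ (-|A|/2)` is the one at which the log-determinant bound turns into the squared
  -- noise term of `radius`.
  have hville := mul_measure_exists_ge_le ℱ hD hstep (ENNReal.ofReal (Real.sqrt c ^ A.card)⁻¹)
  have hD0 : ∫⁻ ω, D 0 ω ∂μ = 1 := by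
    simp [D, mixture_zero, hl]
  rw [hD0, ENNReal.ofReal_inv_of_pos hK] at hville
  have hle : μ {ω | ∃ n, (ENNReal.ofReal (Real.sqrt c ^ A.card))⁻¹ ≤ D n ω} ≤
      ENNReal.ofReal (Real.sqrt c ^ A.card) := by
    have h2 := mul_le_mul_right hville (ENNReal.ofReal (Real.sqrt c ^ A.card))
    rwa [← mul_assoc, ENNReal.mul_inv_cancel (ENNReal.ofReal_pos.2 hK).ne' ENNReal.ofReal_ne_top,
      one_mul, mul_one] at h2
  refine le_trans (measure_mono_ae ?_) hle
  filter_upwards [hM.ae_reward_eq] with ω hω hbad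
  obtain ⟨n, hn⟩ := hbad
  refine ⟨n, ?_⟩
  by_contra hlt
  apply hn
  have hnorm : ∀ k, ‖E.action k ω‖ ≤ L := fun k => hM.norm_action_le k ω _ (hact k ω)
  refine mem_confidenceSet _ n hl hR (z := fun k => E.noise θ R k ω) hM.norm_weight_le ?_ hω ?_
  · intro i hi
    by_contra h
    exact hi (hA (by simpa [supp] using h))
  · refine noiseForm_le_of_mixture_lt A _ _ n hl hc hnorm ?_
    rw [not_le, ← ENNReal.ofReal_inv_of_pos hK] at hlt
    exact (ENNReal.ofReal_lt_ofReal_iff (by positivity)).1 hlt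

end IsFeatureFeedbackModel

end Interaction

end Confidence

/-! ### Known features, the loop counter and exploration probabilities. -/

namespace Interaction

variable {Ω : Type*} {d : ℕ} {E : Interaction Ω d}

theorem mem_known {n : ℕ} {ω : Ω} {j : Fin d} :
    j ∈ E.known n ω ↔ ∃ k < n, j ∈ E.feedback k ω := by
  simp [known]

theorem known_mono (E : Interaction Ω d) (ω : Ω) : Monotone fun n => E.known n ω := by
  intro m n h j hj
  obtain ⟨k, hk, hj⟩ := mem_known.1 hj
  exact mem_known.2 ⟨k, hk.trans_le h, hj⟩

theorem loopIndex_le (E : Interaction Ω d) (n : ℕ) (ω : Ω) : E.loopIndex n ω ≤ n + 1 :=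
  (Finset.card_filter_le _ _).trans (by simp)

theorem le_loopIndex {n k : ℕ} {ω : Ω} (h : (E.known k ω).Nonempty) :
    n + 1 - k ≤ E.loopIndex n ω := by
  -- All rounds `k, …, n` count, round `n` included; truncated subtraction covers `k > n`.
  have h1 : Finset.Ico k (n + 1) ⊆
      (Finset.range (n + 1)).filter fun m => (E.known m ω).Nonempty := by
    intro m hm
    rw [Finset.mem_Ico] at hm
    exact Finset.mem_filter.2 ⟨Finset.mem_range.2 hm.2, h.mono (E.known_mono ω hm.1)⟩
  simpa [loopIndex] using Finset.card_le_card h1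

theorem exploreProb_nonneg (E : Interaction Ω d) (n : ℕ) (ω : Ω) : 0 ≤ E.exploreProb n ω := by
  unfold exploreProb
  split_ifs
  · exact zero_le_one
  · positivity

theorem le_exploreProb (E : Interaction Ω d) (n : ℕ) (ω : Ω) :
    1 / Real.sqrt (n + 1) ≤ E.exploreProb n ω := by
  unfold exploreProb
  split_ifs with h
  · rw [div_le_one (by positivity), Real.one_le_sqrt]
    simp
  · have h1 : (0 : ℝ) < E.loopIndex n ω := by exact_mod_cast Nat.pos_of_ne_zero h
    have h2 : (E.loopIndex n ω : ℝ) ≤ n + 1 := by exact_mod_cast E.loopIndex_le n ω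
    gcongr

/-- Each of the `n` terms is at least `1/√n`, whether the round belongs to the initial phase or to
the loop. -/
theorem sqrt_le_sum_exploreProb (E : Interaction Ω d) (n : ℕ) (ω : Ω) :
    Real.sqrt n ≤ ∑ k ∈ Finset.range n, E.exploreProb k ω := by
  rcases Nat.eq_zero_or_pos n with rfl | hn
  · simp
  · have hn' : (0 : ℝ) < n := by exact_mod_cast hn
    calc Real.sqrt n = ∑ k ∈ Finset.range n, 1 / Real.sqrt n := by
          rw [Finset.sum_const, Finset.card_range, nsmul_eq_mul, mul_one_div, Real.div_sqrt]
      _ ≤ _ := by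
          refine Finset.sum_le_sum fun k hk => le_trans ?_ (E.le_exploreProb k ω)
          have h1 : (k : ℝ) + 1 ≤ n := by exact_mod_cast Finset.mem_range.1 hk
          gcongr

/-- The indicator of the exploration rounds. -/
noncomputable def exploreInd (E : Interaction Ω d) (n : ℕ) : Ω → ℝ :=
  {ω | E.explore n ω = true}.indicator fun _ => 1

end Interaction

/-! ### Speed of discovery and number of exploration rounds. -/

section Exploration

variable {Ω : Type*} [mΩ : MeasurableSpace Ω] {μ : Measure Ω} [IsProbabilityMeasure μ]

theorem condExp_affine {m : MeasurableSpace Ω} (hm : m ≤ mΩ) {f : Ω → ℝ} (hf : Integrable f μ)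
    (a b : ℝ) : condExp m μ (fun ω => a + b * f ω) =ᵐ[μ] fun ω => a + b * condExp m μ f ω := by
  have h1 : condExp m μ ((fun _ => a) + b • f) =ᵐ[μ]
      condExp m μ (fun _ => a) + condExp m μ (b • f) :=
    condExp_add (integrable_const a) (hf.smul b) m
  have h2 : condExp m μ (b • f) =ᵐ[μ] b • condExp m μ f := condExp_smul b f m
  have h3 : condExp m μ (fun _ => a) = fun _ => a := condExp_const hm a
  have h4 : (fun ω => a + b * f ω) = (fun _ => a) + b • f := rfl
  rw [h4]
  filter_upwards [h1, h2] with ω e1 e2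
  rw [e1, Pi.add_apply, e2, h3]
  rfl

variable {d : ℕ} {ℱ 𝒢 : Filtration ℕ mΩ} {E : Interaction Ω d} {θ : Vec d} {N : Finset (Fin d)}
  {S L R p lam c : ℝ}

namespace Interaction

theorem IsFFOFUL.condExp_exploreInd (hF : E.IsFFOFUL μ ℱ S L R lam c)
    (hne : ∀ n ω, (E.actions n ω).Nonempty) (n : ℕ) :
    condExp (ℱ n) μ (E.exploreInd n) =ᵐ[μ] E.exploreProb n := by
  have h := hF.explore_uniform n Set.univ MeasurableSet.univ
  simp only [Set.mem_univ, and_true] at h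
  refine h.trans (Filter.Eventually.of_forall fun ω => ?_)
  have h1 : ((E.actions n ω).card : ℝ) ≠ 0 := by
    exact_mod_cast (Finset.card_pos.2 (hne n ω)).ne'
  simp [actionCount, h1]

namespace IsFeatureFeedbackModel

theorem measurableSet_mem_known (hM : E.IsFeatureFeedbackModel μ ℱ 𝒢 θ N S L R p) {k n : ℕ}
    (h : k ≤ n) (j : Fin d) : MeasurableSet[ℱ n] {ω | j ∈ E.known k ω} := by
  have : {ω | j ∈ E.known k ω} = ⋃ i : Fin k, {ω | j ∈ E.feedback i ω} := by
    ext ω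
    simp only [Set.mem_ofPred_eq, mem_known, Set.mem_iUnion]
    exact ⟨fun ⟨i, hi, hj⟩ => ⟨⟨i, hi⟩, hj⟩, fun ⟨i, hj⟩ => ⟨i, i.2, hj⟩⟩
  rw [this]
  exact MeasurableSet.iUnion fun i =>
    ℱ.mono (Nat.succ_le_of_lt (i.2.trans_le h)) _ (hM.measurable_feedback i j)

theorem measurable_exploreProb (hM : E.IsFeatureFeedbackModel μ ℱ 𝒢 θ N S L R p) {k n : ℕ}
    (h : k ≤ n) : Measurable[ℱ n] (E.exploreProb k) := by
  have hne : ∀ i ≤ k, MeasurableSet[ℱ n] {ω | (E.known i ω).Nonempty} := by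
    intro i hi
    have : {ω | (E.known i ω).Nonempty} = ⋃ j, {ω | j ∈ E.known i ω} := by
      ext ω
      simp [Finset.Nonempty]
    rw [this]
    exact MeasurableSet.iUnion fun j => hM.measurableSet_mem_known (hi.trans h) j
  have hl : Measurable[ℱ n] (E.loopIndex k) := by
    have : E.loopIndex k = fun ω => ∑ i ∈ Finset.range (k + 1),
        if (E.known i ω).Nonempty then 1 else 0 := by
      ext ω
      rw [loopIndex, Finset.card_filter]
    rw [this]
    refine Finset.measurable_sum _ fun i hi => ?_
    exact Measurable.ite (hne i (Nat.lt_succ_iff.1 (Finset.mem_range.1 hi))) measurable_const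
      measurable_const
  exact (measurable_from_top (f := fun l : ℕ => if l = 0 then (1 : ℝ) else 1 / Real.sqrt l)).comp hl

theorem measurableSet_explore (hM : E.IsFeatureFeedbackModel μ ℱ 𝒢 θ N S L R p) {k n : ℕ}
    (h : k < n) : MeasurableSet[ℱ n] {ω | E.explore k ω = true} :=
  ((hM.le_next k).trans (ℱ.mono h)) _
    (hM.measurable_explore k (measurableSet_singleton true))

theorem measurable_exploreInd (hM : E.IsFeatureFeedbackModel μ ℱ 𝒢 θ N S L R p) {k n : ℕ}
    (h : k < n) : Measurable[ℱ n] (E.exploreInd k) :=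
  measurable_const.indicator (hM.measurableSet_explore h)

theorem integrable_exploreInd (hM : E.IsFeatureFeedbackModel μ ℱ 𝒢 θ N S L R p) (n : ℕ) :
    Integrable (E.exploreInd n) μ :=
  (integrable_const (1 : ℝ)).indicator (ℱ.le _ _ (hM.measurableSet_explore (Nat.lt_succ_self n)))

/-- A relevant feature is unknown after `n` rounds with probability at most `exp (-p √n)`. -/
theorem measure_notMem_known_le (hM : E.IsFeatureFeedbackModel μ ℱ 𝒢 θ N S L R p)
    (hF : E.IsFFOFUL μ ℱ S L R lam c) (hp : 0 ≤ p) {j : Fin d} (hj : j ∈ supp θ) (n : ℕ) :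
    μ {ω | j ∉ E.known n ω} ≤ ENNReal.ofReal (Real.exp (-(p * Real.sqrt n))) := by
  let U : ℕ → Set Ω := fun n => {ω | j ∉ E.known n ω}
  -- With exploration probability `q`, feature `j` stays unknown with conditional probability at
  -- most `1 - p q ≤ exp (-p q)`; the exponential weight compensates this, so the mean of `W` does
  -- not increase.
  let W : ℕ → Ω → ENNReal := fun n => (U n).indicator fun ω =>
    ENNReal.ofReal (Real.exp (p * ∑ k ∈ Finset.range n, E.exploreProb k ω))
  have hU : ∀ n, MeasurableSet[ℱ n] (U n) := fun n => (hM.measurableSet_mem_known le_rfl j).compl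
  have hW : ∀ n, Measurable[ℱ n] (W n) := fun n =>
    (((Finset.measurable_sum _ fun k hk => hM.measurable_exploreProb
      (Finset.mem_range.1 hk).le).const_mul p).exp.ennreal_ofReal).indicator (hU n)
  have hstep : ∀ n, ∫⁻ ω, W (n + 1) ω ∂μ ≤ ∫⁻ ω, W n ω ∂μ := by
    intro n
    let B : Set Ω := {ω | E.explore n ω = true ∧ j ∈ E.feedback n ω}
    have hB : MeasurableSet B :=
      (ℱ.le _ _ (hM.measurableSet_explore (Nat.lt_succ_self n))).inter
        (ℱ.le _ _ (hM.measurable_feedback n j))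
    have hBi : Integrable (B.indicator fun _ => (1 : ℝ)) μ := (integrable_const _).indicator hB
    have hB1 : ∀ ω, B.indicator (fun _ => (1 : ℝ)) ω ≤ 1 := fun ω =>
      Set.indicator_le' (s := B) (f := fun _ => (1 : ℝ)) (g := fun _ => 1) (fun _ _ => le_rfl)
        (fun _ _ => zero_le_one) ω
    have hcond : condExp (ℱ n) μ (fun ω => 1 + -1 * B.indicator (fun _ => (1 : ℝ)) ω) ≤ᵐ[μ]
        fun ω => Real.exp (-(p * E.exploreProb n ω)) := by
      filter_upwards [condExp_affine (ℱ.le n) hBi 1 (-1), hM.discoverable n j hj,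
        hF.condExp_exploreInd hM.actions_nonempty n] with ω h1 h2 h3
      rw [h1]
      have h4 := Real.add_one_le_exp (-(p * E.exploreProb n ω))
      rw [← h3] at h4 ⊢
      change p * condExp (ℱ n) μ (E.exploreInd n) ω ≤ _ at h2
      linarith
    have h := lintegral_mul_le_of_condExp_le (ℱ.le n)
      (f := fun ω => 1 + -1 * B.indicator (fun _ => (1 : ℝ)) ω)
      ((integrable_const 1).add (hBi.const_mul (-1))) (fun ω => by
        have := hB1 ω
        simp only [Pi.zero_apply]
        linarith) hcond
      (Z := fun ω => W n ω * ENNReal.ofReal (Real.exp (p * E.exploreProb n ω)))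
      ((hW n).mul ((hM.measurable_exploreProb le_rfl).const_mul p).exp.ennreal_ofReal)
    refine le_trans (lintegral_mono fun ω => ?_) (h.trans (lintegral_mono fun ω => le_of_eq ?_))
    · by_cases h1 : ω ∈ U (n + 1)
      · have h2 : ω ∈ U n := fun h => h1 (E.known_mono ω (Nat.le_succ n) h)
        have h3 : ω ∉ B := fun h => h1 (mem_known.2 ⟨n, Nat.lt_succ_self n, h.2⟩)
        simp only [W]
        rw [Set.indicator_of_mem h1, Set.indicator_of_mem h2, Set.indicator_of_notMem h3,
          ← ENNReal.ofReal_mul (Real.exp_pos _).le, ← Real.exp_add, Finset.sum_range_succ, mul_add]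
        simp
      · simp only [W]
        rw [Set.indicator_of_notMem h1]
        exact zero_le
    · rw [mul_assoc, ← ENNReal.ofReal_mul (Real.exp_pos _).le, ← Real.exp_add]
      simp
  have hmain : ∀ n, ∫⁻ ω, W n ω ∂μ ≤ 1 := by
    intro n
    induction n with
    | zero =>
      calc ∫⁻ ω, W 0 ω ∂μ ≤ ∫⁻ _, 1 ∂μ := lintegral_mono fun ω =>
            Set.indicator_le' (s := U 0) (g := fun _ => (1 : ENNReal)) (fun _ _ => by simp)
              (fun _ _ => zero_le_one) ω
        _ = 1 := by simp
    | succ n ih => exact (hstep n).trans ih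
  have h1 : ENNReal.ofReal (Real.exp (p * Real.sqrt n)) * μ (U n) ≤ 1 := by
    refine le_trans ?_ (hmain n)
    rw [← lintegral_indicator_const (ℱ.le n _ (hU n))]
    refine lintegral_mono fun ω => Set.indicator_le_indicator ?_
    gcongr
    exact E.sqrt_le_sum_exploreProb n ω
  have h2 := mul_le_mul_right h1 (ENNReal.ofReal (Real.exp (-(p * Real.sqrt n))))
  rwa [← mul_assoc, ← ENNReal.ofReal_mul (Real.exp_pos _).le, ← Real.exp_add, neg_add_cancel,
    Real.exp_zero, ENNReal.ofReal_one, one_mul, mul_one] at h2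

/-- The number of exploration rounds exceeds twice its compensator by `a` with probability at most
`exp (-a)`. -/
theorem measure_sum_exploreInd_ge_le (hM : E.IsFeatureFeedbackModel μ ℱ 𝒢 θ N S L R p)
    (hF : E.IsFFOFUL μ ℱ S L R lam c) (n T : ℕ) (a : ℝ) :
    μ {ω | a ≤ ∑ i ∈ Finset.range T, (E.exploreInd (n + i) ω - 2 * E.exploreProb (n + i) ω)} ≤
      ENNReal.ofReal (Real.exp (-a)) := by
  let Y : ℕ → Ω → ℝ := fun T ω =>
    ∑ i ∈ Finset.range T, (E.exploreInd (n + i) ω - 2 * E.exploreProb (n + i) ω)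
  let W : ℕ → Ω → ENNReal := fun T ω => ENNReal.ofReal (Real.exp (Y T ω))
  have hY : ∀ T, Measurable[ℱ (n + T)] (Y T) := fun T =>
    Finset.measurable_sum _ fun i hi => by
      have hi' := Finset.mem_range.1 hi
      exact (hM.measurable_exploreInd (by omega)).sub
        ((hM.measurable_exploreProb (by omega)).const_mul 2)
  have hW : ∀ T, Measurable[ℱ (n + T)] (W T) := fun T => (hY T).exp.ennreal_ofReal
  -- Source of the factor `2`: the conditional mean of `exp (exploreInd)` is `1 + (e - 1) q ≤ exp (2
  -- q)`.
  have he : Real.exp 1 - 1 ≤ 2 := by linarith [Real.exp_one_lt_d9]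
  have hexp : ∀ k ω, Real.exp (E.exploreInd k ω) = 1 + (Real.exp 1 - 1) * E.exploreInd k ω := by
    intro k ω
    unfold exploreInd
    by_cases h : ω ∈ {ω | E.explore k ω = true}
    · rw [Set.indicator_of_mem h]; ring
    · rw [Set.indicator_of_notMem h]; simp
  have hstep : ∀ T, ∫⁻ ω, W (T + 1) ω ∂μ ≤ ∫⁻ ω, W T ω ∂μ := by
    intro T
    have hcond : condExp (ℱ (n + T)) μ
        (fun ω => 1 + (Real.exp 1 - 1) * E.exploreInd (n + T) ω) ≤ᵐ[μ]
        fun ω => Real.exp (2 * E.exploreProb (n + T) ω) := by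
      filter_upwards [condExp_affine (ℱ.le (n + T)) (hM.integrable_exploreInd (n + T)) 1
        (Real.exp 1 - 1), hF.condExp_exploreInd hM.actions_nonempty (n + T)] with ω h1 h2
      rw [h1, h2]
      have h4 := Real.add_one_le_exp (2 * E.exploreProb (n + T) ω)
      have h5 := mul_le_mul_of_nonneg_right he (E.exploreProb_nonneg (n + T) ω)
      linarith
    have h := lintegral_mul_le_of_condExp_le (ℱ.le (n + T))
      (f := fun ω => 1 + (Real.exp 1 - 1) * E.exploreInd (n + T) ω) ((integrable_const 1).add
      ((hM.integrable_exploreInd (n + T)).const_mul (Real.exp 1 - 1))) (fun ω =>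
        (Real.exp_pos _).le.trans_eq (hexp (n + T) ω)) hcond
      (Z := fun ω => W T ω * ENNReal.ofReal (Real.exp (-(2 * E.exploreProb (n + T) ω))))
      ((hW T).mul ((hM.measurable_exploreProb le_rfl).const_mul 2).neg.exp.ennreal_ofReal)
    refine le_trans (lintegral_mono fun ω => le_of_eq ?_)
      (h.trans (lintegral_mono fun ω => le_of_eq ?_))
    · simp only [W, Y]
      rw [← hexp, ← ENNReal.ofReal_mul (Real.exp_pos _).le, ← Real.exp_add,
        ← ENNReal.ofReal_mul (Real.exp_pos _).le, ← Real.exp_add, Finset.sum_range_succ]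
      congr 2
      ring
    · rw [mul_assoc, ← ENNReal.ofReal_mul (Real.exp_pos _).le, ← Real.exp_add]
      simp
  have hmain : ∫⁻ ω, W T ω ∂μ ≤ 1 := by
    induction T with
    | zero => simp [W, Y]
    | succ T ih => exact (hstep T).trans ih
  have h1 := (mul_meas_ge_le_lintegral₀ ((hW T).mono (ℱ.le _) le_rfl).aemeasurable
    (ENNReal.ofReal (Real.exp a))).trans hmain
  have hset : {ω | ENNReal.ofReal (Real.exp a) ≤ W T ω} = {ω | a ≤ Y T ω} := by
    ext ω
    simp only [Set.mem_ofPred_eq, W]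
    rw [ENNReal.ofReal_le_ofReal_iff (Real.exp_pos _).le, Real.exp_le_exp]
  rw [hset] at h1
  have h2 := mul_le_mul_right h1 (ENNReal.ofReal (Real.exp (-a)))
  rwa [← mul_assoc, ← ENNReal.ofReal_mul (Real.exp_pos _).le, ← Real.exp_add, neg_add_cancel,
    Real.exp_zero, ENNReal.ofReal_one, one_mul, mul_one] at h2

end IsFeatureFeedbackModel

end Interaction

end Exploration

/-! ### The regret on a good path. -/

section Pathwise

theorem sum_one_div_sqrt_le (T : ℕ) :
    ∑ i ∈ Finset.range T, 1 / Real.sqrt ((i : ℝ) + 1) ≤ 2 * Real.sqrt T := by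
  induction T with
  | zero => simp
  | succ T ih =>
    rw [Finset.sum_range_succ]
    push_cast
    have h1 : 0 < Real.sqrt ((T : ℝ) + 1) := by positivity
    have h2 : Real.sqrt ((T : ℝ) + 1) ^ 2 = T + 1 := Real.sq_sqrt (by positivity)
    have h3 : Real.sqrt (T : ℝ) ^ 2 = T := Real.sq_sqrt (by positivity)
    have h4 : 1 / Real.sqrt ((T : ℝ) + 1) ≤
        2 * Real.sqrt ((T : ℝ) + 1) - 2 * Real.sqrt T := by
      rw [div_le_iff₀ h1]
      nlinarith [sq_nonneg (Real.sqrt ((T : ℝ) + 1) - Real.sqrt T)]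
    linarith

theorem radius_mono {S L R lam c : ℝ} (hl : 0 < lam) (hR : 0 ≤ R) (hc : 0 < c) (hc1 : c ≤ 1)
    {r r' n n' : ℕ} (hr : r ≤ r') (hn : n ≤ n') :
    radius S L R lam c r n ≤ radius S L R lam c r' n' := by
  have hn' : (n : ℝ) ≤ n' := by exact_mod_cast hn
  have hr' : (r : ℝ) ≤ r' := by exact_mod_cast hr
  have hpos : ∀ k : ℕ, 1 ≤ (1 + k * L ^ 2 / lam) / c := by
    intro k
    have : 0 ≤ k * L ^ 2 / lam := by positivity
    rw [one_le_div hc]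
    linarith
  have h0 := Real.log_nonneg (hpos n)
  have h1 := hpos n
  unfold radius
  gcongr

variable {d : ℕ} {S L R lam c : ℝ}

/-- Two elements of a confidence ellipsoid are close in the direction of an action, measured by the
Gram matrix on any larger feature set. -/
theorem dotProduct_sub_le_of_mem_confidenceSet (hl : 0 < lam) {A B : Finset (Fin d)} (hAB : A ⊆ B)
    {x : ℕ → Vec d} {y : ℕ → ℝ} {n : ℕ} {θ₁ θ₂ : Vec d}
    (h₁ : θ₁ ∈ confidenceSet S L R lam c A x y n) (h₂ : θ₂ ∈ confidenceSet S L R lam c A x y n)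
    (v : Vec d) :
    inner ℝ v θ₁ - inner ℝ v θ₂ ≤
      Real.sqrt (restrict B v ⬝ᵥ ((gram lam B x n)⁻¹ *ᵥ restrict B v)) *
        (2 * radius S L R lam c A.card n) := by
  set Δ : Fin d → ℝ := θ₁.ofLp - θ₂.ofLp with hΔ
  have hA : ∀ i, i ∉ A → Δ i = 0 := fun i hi => by
    simp only [hΔ, Pi.sub_apply]
    rw [h₁.1 i hi, h₂.1 i hi, sub_zero]
  have hB : ∀ i, i ∉ B → Δ i = 0 := fun i hi => hA i fun h => hi (hAB h)
  -- `Δ` vanishes off `A`, so enlarging the feature set does not change its Gram norm.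
  have hquad : Δ ⬝ᵥ (gram lam B x n *ᵥ Δ) = Δ ⬝ᵥ (gram lam A x n *ᵥ Δ) := by
    rw [gram_quadForm, gram_quadForm]
    congr 1
    refine Finset.sum_congr rfl fun m _ => ?_
    rw [restrict_dotProduct_of_support _ hA, restrict_dotProduct_of_support _ hB]
  have hnorm : Real.sqrt (Δ ⬝ᵥ (gram lam A x n *ᵥ Δ)) ≤ 2 * radius S L R lam c A.card n := by
    have hsplit : Δ = -(ridge lam A x y n - θ₁.ofLp) + (ridge lam A x y n - θ₂.ofLp) := by
      rw [hΔ]; abel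
    rw [hsplit]
    refine (sqrt_quadForm_add_le (gram_posDef A x n hl) _ _).trans ?_
    rw [quadForm_neg]
    linarith [h₁.2, h₂.2]
  have hinner : inner ℝ v θ₁ - inner ℝ v θ₂ = restrict B v ⬝ᵥ Δ := by
    rw [restrict_dotProduct_of_support _ hB, inner_eq_dotProduct, inner_eq_dotProduct, hΔ,
      dotProduct_sub]
  rw [hinner]
  refine (dotProduct_le_sqrt (gram_posDef B x n hl) _ _).trans ?_
  rw [hquad]
  gcongr

variable {Ω : Type*} {E : Interaction Ω d} {θ : Vec d}

namespace Interaction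

theorem instRegret_le_of_forall {n : ℕ} {ω : Ω} (hne : (E.actions n ω).Nonempty) {b : ℝ}
    (h : ∀ x ∈ E.actions n ω, inner ℝ x θ ≤ b + inner ℝ (E.action n ω) θ) :
    E.instRegret θ n ω ≤ b := by
  unfold instRegret
  rw [sub_le_iff_le_add]
  refine csSup_le ?_ ?_
  · exact (Finset.coe_nonempty.2 hne).image _
  · rintro _ ⟨x, hx, rfl⟩
    exact h x hx

theorem instRegret_zero (n : ℕ) (ω : Ω) (hne : (E.actions n ω).Nonempty) :
    E.instRegret 0 n ω ≤ 0 :=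
  instRegret_le_of_forall hne fun x _ => by simp

theorem exploreProb_add_le {n i : ℕ} {ω : Ω} (h : (E.known n ω).Nonempty) :
    E.exploreProb (n + i) ω ≤ 1 / Real.sqrt ((i : ℝ) + 1) := by
  have h1 : i + 1 ≤ E.loopIndex (n + i) ω := by
    have := le_loopIndex (n := n + i) h
    omega
  have h2 : (i : ℝ) + 1 ≤ E.loopIndex (n + i) ω := by exact_mod_cast h1
  rw [exploreProb, if_neg (by omega)]
  gcongr

variable [mΩ : MeasurableSpace Ω] {μ : Measure Ω} {ℱ 𝒢 : Filtration ℕ mΩ} {N : Finset (Fin d)}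
  {p : ℝ}

theorem instRegret_le_two (hM : E.IsFeatureFeedbackModel μ ℱ 𝒢 θ N S L R p)
    (hF : E.IsFFOFUL μ ℱ S L R lam c) (n : ℕ) (ω : Ω) : E.instRegret θ n ω ≤ 2 :=
  instRegret_le_of_forall (hM.actions_nonempty n ω) fun x hx => by
    have h1 := (hM.mean_reward_mem n ω x hx).2
    have h2 := (hM.mean_reward_mem n ω _ (hF.action_mem n ω)).1
    linarith

/-- The uncertainty of the action of round `n` on the feature set `B`, truncated at `1`. -/
noncomputable def uncertainty (E : Interaction Ω d) (lam : ℝ) (B : Finset (Fin d)) (n : ℕ) (ω : Ω) :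
    ℝ :=
  min 1 (restrict B (E.action n ω) ⬝ᵥ
    ((gram lam B (fun m => E.action m ω) n)⁻¹ *ᵥ restrict B (E.action n ω)))

theorem uncertainty_nonneg (hl : 0 < lam) (B : Finset (Fin d)) (n : ℕ) (ω : Ω) :
    0 ≤ E.uncertainty lam B n ω :=
  le_min zero_le_one (gram_inv_quadForm_nonneg _ _ _ hl _)

/-- Exploring costs at most `2`. When exploiting, `θ` competes in the optimistic maximization, so
the regret is at most the width of the ellipsoid in the direction played. Where the uncertainty is
truncated at `1`, the trivial bound `2 ≤ 2 b` suffices; this is the role of `1 ≤ b`. -/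
theorem instRegret_le (hM : E.IsFeatureFeedbackModel μ ℱ 𝒢 θ N S L R p)
    (hF : E.IsFFOFUL μ ℱ S L R lam c) (hl : 0 < lam) {n : ℕ} {ω : Ω} {B : Finset (Fin d)}
    (hB : E.known n ω ⊆ B) {b : ℝ} (hb : 1 ≤ b)
    (hrad : radius S L R lam c (E.known n ω).card n ≤ b)
    (hθ : θ ∈ confidenceSet S L R lam c (E.known n ω) (fun m => E.action m ω)
      (fun m => E.reward m ω) n) :
    E.instRegret θ n ω ≤ 2 * E.exploreInd n ω + 2 * b * Real.sqrt (E.uncertainty lam B n ω) := by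
  have h2 := instRegret_le_two hM hF n ω
  have hu : 0 ≤ 2 * b * Real.sqrt (E.uncertainty lam B n ω) := by positivity
  by_cases he : E.explore n ω = true
  · have : E.exploreInd n ω = 1 := Set.indicator_of_mem (s := {ω | E.explore n ω = true}) he _
    rw [this]
    linarith
  · have h0 : E.exploreInd n ω = 0 :=
      Set.indicator_of_notMem (s := {ω | E.explore n ω = true}) he _
    rw [h0, mul_zero, zero_add]
    obtain ⟨θ₁, hθ₁, hopt⟩ := hF.exploit_optimistic n ω (by simpa using he)
    have hreg : E.instRegret θ n ω ≤
        inner ℝ (E.action n ω) θ₁ - inner ℝ (E.action n ω) θ :=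
      instRegret_le_of_forall (hM.actions_nonempty n ω) fun x hx => by
        linarith [hopt x hx θ hθ]
    have hdiff := dotProduct_sub_le_of_mem_confidenceSet hl hB hθ₁ hθ (E.action n ω)
    unfold uncertainty
    rcases min_choice 1 (restrict B (E.action n ω) ⬝ᵥ
      ((gram lam B (fun m => E.action m ω) n)⁻¹ *ᵥ restrict B (E.action n ω))) with h | h
    · rw [h, Real.sqrt_one]
      linarith
    · rw [h]
      refine hreg.trans (hdiff.trans ?_)
      rw [mul_comm]
      gcongr

/-- The regret on a path on which all relevant features are known after `n` rounds, exploration is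
not too frequent afterwards and the confidence ellipsoids contain the true parameter. -/
theorem regret_le (hM : E.IsFeatureFeedbackModel μ ℱ 𝒢 θ N S L R p)
    (hF : E.IsFFOFUL μ ℱ S L R lam c) (hl : 0 < lam) {n T : ℕ} {ω : Ω} {B : Finset (Fin d)}
    (hB : ∀ m, E.known m ω ⊆ B) {b a : ℝ} (hb : 1 ≤ b)
    (hrad : ∀ m < n + T, radius S L R lam c (E.known m ω).card m ≤ b)
    (hknown : (E.known n ω).Nonempty)
    (hθ : ∀ m, n ≤ m → θ ∈ confidenceSet S L R lam c (E.known m ω) (fun m => E.action m ω)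
      (fun m => E.reward m ω) m)
    (hexp : ∑ i ∈ Finset.range T, (E.exploreInd (n + i) ω - 2 * E.exploreProb (n + i) ω) ≤ a) :
    E.regret θ T ω ≤ ENNReal.ofReal (2 * n + 2 * (4 * Real.sqrt T + a) +
      2 * b * (Real.sqrt T *
        Real.sqrt (2 * (B.card * Real.log (1 + ((n + T : ℕ) : ℝ) * L ^ 2 / lam))))) := by
  let g : ℕ → ℝ := fun m => if m < n then 2 else
    2 * E.exploreInd m ω + 2 * b * Real.sqrt (E.uncertainty lam B m ω)
  have hind : ∀ m, 0 ≤ E.exploreInd m ω := fun m => Set.indicator_nonneg (fun _ _ => zero_le_one) ω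
  have hg0 : ∀ m, 0 ≤ g m := by
    intro m
    simp only [g]
    split_ifs
    · norm_num
    · have := hind m
      positivity
  have hg : ∀ m, E.instRegret θ m ω ≤ g m ∨ n + T ≤ m := by
    intro m
    rcases lt_or_ge m (n + T) with hm | hm
    · left
      simp only [g]
      split_ifs with h
      · exact instRegret_le_two hM hF m ω
      · exact instRegret_le hM hF hl (hB m) hb (hrad m hm) (hθ m (not_lt.1 h))
    · exact Or.inr hm
  -- The loop has started by round `n`, so its counter exceeds `T` from round `n + T` on and the
  -- regret series is a finite sum.
  have hlate : ∀ m, n + T ≤ m → ¬ E.loopIndex m ω ≤ T := by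
    intro m hm
    have := le_loopIndex (n := m) hknown
    omega
  have hsum : E.regret θ T ω ≤ ENNReal.ofReal (∑ m ∈ Finset.range (n + T), g m) := by
    unfold regret
    rw [tsum_eq_sum (s := Finset.range (n + T)), ENNReal.ofReal_sum_of_nonneg fun m _ => hg0 m]
    · refine Finset.sum_le_sum fun m hm => ?_
      split_ifs
      · rcases hg m with h | h
        · exact ENNReal.ofReal_le_ofReal h
        · exact absurd (Finset.mem_range.1 hm) (not_lt.2 h)
      · exact zero_le
    · intro m hm
      rw [if_neg (hlate m (by simpa using hm))]
  refine hsum.trans (ENNReal.ofReal_le_ofReal ?_)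
  have h1 : ∑ m ∈ Finset.range n, g m = 2 * n := by
    rw [Finset.sum_congr rfl fun m hm => if_pos (Finset.mem_range.1 hm)]
    simp [mul_comm]
  have h2 : ∑ i ∈ Finset.range T, g (n + i) = 2 * ∑ i ∈ Finset.range T, E.exploreInd (n + i) ω +
      2 * b * ∑ i ∈ Finset.range T, Real.sqrt (E.uncertainty lam B (n + i) ω) := by
    rw [Finset.mul_sum, Finset.mul_sum, ← Finset.sum_add_distrib]
    exact Finset.sum_congr rfl fun i _ => if_neg (by omega)
  have h3 : ∑ i ∈ Finset.range T, E.exploreInd (n + i) ω ≤ 4 * Real.sqrt T + a := by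
    have hq : ∑ i ∈ Finset.range T, E.exploreProb (n + i) ω ≤ 2 * Real.sqrt T :=
      (Finset.sum_le_sum fun i _ => exploreProb_add_le hknown).trans (sum_one_div_sqrt_le T)
    rw [Finset.sum_sub_distrib, ← Finset.mul_sum] at hexp
    linarith
  have hpot : ∑ i ∈ Finset.range T, E.uncertainty lam B (n + i) ω ≤
      2 * (B.card * Real.log (1 + ((n + T : ℕ) : ℝ) * L ^ 2 / lam)) := by
    -- The Gram matrices contain all rounds from `0` on, so the potential is summed from there and
    -- the first `n` nonnegative terms are dropped.
    refine le_trans ?_ (sum_min_one_le B (fun m => E.action m ω) (n + T) hl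
      fun m => hM.norm_action_le m ω _ (hF.action_mem m ω))
    rw [Finset.sum_range_add]
    exact le_add_of_nonneg_left (Finset.sum_nonneg fun m _ => uncertainty_nonneg hl B m ω)
  have h4 : ∑ i ∈ Finset.range T, Real.sqrt (E.uncertainty lam B (n + i) ω) ≤ Real.sqrt T *
      Real.sqrt (2 * (B.card * Real.log (1 + ((n + T : ℕ) : ℝ) * L ^ 2 / lam))) := by
    have hcs := Real.sum_sqrt_mul_sqrt_le (Finset.range T) (f := fun _ => 1)
      (g := fun i => E.uncertainty lam B (n + i) ω) (fun _ => zero_le_one)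
      (fun i => uncertainty_nonneg hl B (n + i) ω)
    simp only [Real.sqrt_one, one_mul, Finset.sum_const, Finset.card_range, nsmul_eq_mul,
      mul_one] at hcs
    refine hcs.trans ?_
    gcongr
  rw [Finset.sum_range_add, h1, h2]
  have h5 : 0 ≤ 2 * b := by linarith
  have h6 := mul_le_mul_of_nonneg_left h4 h5
  linarith

end Interaction

end Pathwise

/-! ### Numerical estimates behind the final constant. -/

section Constants

/-- Here `n ≤ 2 Q ^ 4` and `T + 1 ≤ Q ^ 4`, so the horizon is at most `3 Q ^ 4 ≤ Q ^ 5`; dividing by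
`c` costs one more `Q`, whence the `6`. -/
theorem log_horizon_le {h c p Q n T : ℝ} (hh : 0 ≤ h) (hc : 0 < c) (hp : 0 < p) (hQ : 3 ≤ Q)
    (hn : n ≤ 2 * Real.log Q ^ 2 / p ^ 2) (hn0 : 0 ≤ n) (hT0 : 0 ≤ T) (hT : T + 1 ≤ Q)
    (hpQ : 1 / p ≤ Q) (hcQ : 1 / c ≤ Q) (hlog : 1 ≤ Real.log Q) :
    Real.log ((1 + (n + T) * h) / c) ≤ (Real.log (1 + h) + 6) * Real.log Q := by
  have hQ0 : 0 < Q := by linarith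
  have h1 : Real.log Q ≤ Q := Real.log_le_self hQ0.le
  have h2 : n ≤ 2 * Q ^ 4 := by
    have e : 2 * Real.log Q ^ 2 / p ^ 2 = 2 * Real.log Q ^ 2 * (1 / p) ^ 2 := by ring
    rw [e] at hn
    refine hn.trans ?_
    calc 2 * Real.log Q ^ 2 * (1 / p) ^ 2 ≤ 2 * Q ^ 2 * Q ^ 2 := by gcongr
      _ = 2 * Q ^ 4 := by ring
  have h3 : Q ≤ Q ^ 4 := le_self_pow₀ (by linarith) (by norm_num)
  have h4 : n + T + 1 ≤ Q ^ 5 := by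
    have : 3 * Q ^ 4 ≤ Q * Q ^ 4 := by gcongr
    calc n + T + 1 ≤ 3 * Q ^ 4 := by linarith
      _ ≤ Q * Q ^ 4 := this
      _ = Q ^ 5 := by ring
  have h5 : (1 + (n + T) * h) / c ≤ (1 + h) * Q ^ 6 := by
    calc (1 + (n + T) * h) / c ≤ ((1 + h) * (n + T + 1)) * (1 / c) := by
          rw [div_eq_mul_one_div]
          gcongr
          nlinarith
      _ ≤ ((1 + h) * Q ^ 5) * Q := by gcongr
      _ = (1 + h) * Q ^ 6 := by ring
  have h6 : 0 ≤ Real.log (1 + h) := Real.log_nonneg (by linarith)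
  have hpos : 0 < (1 + (n + T) * h) / c := by positivity
  calc Real.log ((1 + (n + T) * h) / c) ≤ Real.log ((1 + h) * Q ^ 6) := Real.log_le_log hpos h5
    _ = Real.log (1 + h) + 6 * Real.log Q := by
        rw [Real.log_mul (by positivity) (by positivity), Real.log_pow]
        norm_num
    _ ≤ (Real.log (1 + h) + 6) * Real.log Q := by nlinarith

/-- The leading constant of the regret bound. -/
noncomputable def regretConst (S L R lam : ℝ) : ℝ :=
  14 + 4 * (R + Real.sqrt lam * S + 1) * (Real.log (1 + L ^ 2 / lam) + 6)

theorem regretConst_pos {S L R lam : ℝ} (hS : 0 ≤ S) (hR : 0 ≤ R) (hl : 0 < lam) :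
    0 < regretConst S L R lam := by
  have h : 0 ≤ L ^ 2 / lam := by positivity
  have : 0 ≤ Real.log (1 + L ^ 2 / lam) := Real.log_nonneg (by linarith)
  unfold regretConst
  positivity

theorem radius_le {S L R lam c : ℝ} {r n : ℕ} {r' ℓ : ℝ} (hS : 0 ≤ S) (hR : 0 ≤ R) (hr1 : 1 ≤ r')
    (hr : r ≤ r') (hℓ : Real.log ((1 + n * L ^ 2 / lam) / c) ≤ ℓ) (hℓ1 : 1 ≤ ℓ) :
    radius S L R lam c r n ≤ (R + Real.sqrt lam * S + 1) * Real.sqrt (r' * ℓ) := by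
  have h1 : 1 ≤ Real.sqrt (r' * ℓ) := by
    rw [Real.one_le_sqrt]
    nlinarith
  have h2 : (r : ℝ) * Real.log ((1 + n * L ^ 2 / lam) / c) ≤ r' * ℓ := by
    calc (r : ℝ) * Real.log ((1 + n * L ^ 2 / lam) / c) ≤ r * ℓ := by gcongr
      _ ≤ r' * ℓ := by gcongr
  have h3 : 0 ≤ Real.sqrt lam * S := by positivity
  unfold radius
  calc R * Real.sqrt (r * Real.log ((1 + n * L ^ 2 / lam) / c)) + Real.sqrt lam * S
      ≤ R * Real.sqrt (r' * ℓ) + Real.sqrt lam * S * Real.sqrt (r' * ℓ) :=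
        add_le_add (by gcongr) (le_mul_of_one_le_right h3 h1)
    _ ≤ _ := by nlinarith

/-- The `14` in `regretConst` is `4 + 2 + 8`, from the discovery phase, the deviation `a` and the
`√T` explorations. The remaining summand comes from the product of radius and potential, each of
order `√(r ℓ)`. -/
theorem regret_bound_le {S L R lam r ℓ Λ n T a p B g : ℝ} (hS : 0 ≤ S) (hR : 0 ≤ R) (hl : 0 < lam)
    (hr : 1 ≤ r) (hℓ1 : 1 ≤ ℓ) (hℓ : ℓ ≤ (Real.log (1 + L ^ 2 / lam) + 6) * Λ) (hΛ : 1 ≤ Λ)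
    (hn : n ≤ 2 * Λ ^ 2 / p ^ 2) (ha : a ≤ Λ) (hp : 0 < p) (hp1 : p ≤ 1)
    (hB0 : 0 ≤ B) (hB : B ≤ r) (hg : g ≤ ℓ) :
    2 * n + 2 * (4 * Real.sqrt T + a) + 2 * ((R + Real.sqrt lam * S + 1) * Real.sqrt (r * ℓ)) *
      (Real.sqrt T * Real.sqrt (2 * (B * g))) ≤
    regretConst S L R lam * Λ ^ 2 * (r * Real.sqrt T + 1 / p ^ 2) := by
  set K := R + Real.sqrt lam * S + 1 with hK
  have hK0 : 0 ≤ K := by positivity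
  set q := Real.sqrt T with hq
  have hq0 : 0 ≤ q := Real.sqrt_nonneg _
  have hLog : 0 ≤ Real.log (1 + L ^ 2 / lam) := by
    have h : 0 ≤ L ^ 2 / lam := by positivity
    exact Real.log_nonneg (by linarith)
  set M := Real.log (1 + L ^ 2 / lam) + 6 with hM
  have hM0 : 0 ≤ M := by positivity
  have hrl : 0 ≤ r * ℓ := by positivity
  have hΛ2 : Λ ≤ Λ ^ 2 := le_self_pow₀ hΛ (by norm_num)
  have hΛ21 : 1 ≤ Λ ^ 2 := hΛ.trans hΛ2
  have hP : 1 ≤ 1 / p ^ 2 := by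
    rw [one_le_div (by positivity)]
    exact pow_le_one₀ hp.le hp1
  have h1 : Real.sqrt (2 * (B * g)) ≤ 2 * Real.sqrt (r * ℓ) := by
    have e : (2 : ℝ) * Real.sqrt (r * ℓ) = Real.sqrt (4 * (r * ℓ)) := by
      rw [Real.sqrt_mul (by norm_num : (0 : ℝ) ≤ 4), show (4 : ℝ) = 2 ^ 2 by norm_num,
        Real.sqrt_sq (by norm_num : (0 : ℝ) ≤ 2)]
    rw [e]
    apply Real.sqrt_le_sqrt
    have : B * g ≤ r * ℓ := by
      calc B * g ≤ B * ℓ := by gcongr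
        _ ≤ r * ℓ := by gcongr
    linarith
  have h2 : 2 * (K * Real.sqrt (r * ℓ)) * (q * Real.sqrt (2 * (B * g))) ≤
      4 * K * M * Λ ^ 2 * (r * q) := by
    calc 2 * (K * Real.sqrt (r * ℓ)) * (q * Real.sqrt (2 * (B * g)))
        ≤ 2 * (K * Real.sqrt (r * ℓ)) * (q * (2 * Real.sqrt (r * ℓ))) := by gcongr
      _ = 4 * K * q * Real.sqrt (r * ℓ) ^ 2 := by ring
      _ = 4 * K * q * (r * ℓ) := by rw [Real.sq_sqrt hrl]
      _ ≤ 4 * K * q * (r * (M * Λ)) := by gcongr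
      _ ≤ 4 * K * q * (r * (M * Λ ^ 2)) := by gcongr
      _ = _ := by ring
  have h3 : 2 * n ≤ 4 * Λ ^ 2 * (1 / p ^ 2) := by
    have e : 2 * Λ ^ 2 / p ^ 2 = 2 * Λ ^ 2 * (1 / p ^ 2) := by ring
    rw [e] at hn
    linarith
  have h4 : 2 * a ≤ 2 * Λ ^ 2 * (1 / p ^ 2) := by nlinarith
  have h5 : 8 * q ≤ 8 * Λ ^ 2 * (r * q) := by
    have e : q ≤ r * q := le_mul_of_one_le_left hq0 hr
    have e2 : r * q ≤ Λ ^ 2 * (r * q) := le_mul_of_one_le_left (by positivity) hΛ21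
    linarith
  have h6 : 0 ≤ Λ ^ 2 * (r * q) := by positivity
  have h7 : 0 ≤ Λ ^ 2 * (1 / p ^ 2) := by positivity
  have h8 : 0 ≤ K * M * (Λ ^ 2 * (1 / p ^ 2)) := by positivity
  unfold regretConst
  rw [← hK, ← hM]
  nlinarith

/-- The length of the discovery phase, with the numerical facts about it that enter the regret
bound. -/
theorem exists_discovery_length {h s t w p c δ Q : ℝ} (hh : 0 ≤ h) (hs1 : 1 ≤ s) (hsw : s ≤ w)
    (ht1 : 1 ≤ t) (hp : 0 < p) (hp1 : p ≤ 1) (hδ : 0 < δ) (hδ1 : δ < 1) (hc : 0 < c)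
    (hcδ : c ≤ δ / 4) (hQdef : Q = 3 * t * w / (p * c)) :
    ∃ (n : ℕ) (a : ℝ), Real.exp (-a) = δ / (4 * s) ∧ a ≤ p * Real.sqrt n ∧ a ≤ Real.log Q ∧
      (n : ℝ) ≤ 2 * Real.log Q ^ 2 / p ^ 2 ∧ 1 ≤ Real.log Q ∧
      1 ≤ Real.log ((1 + (n + (t - 1)) * h) / c) ∧
      Real.log ((1 + (n + (t - 1)) * h) / c) ≤ (Real.log (1 + h) + 6) * Real.log Q := by
  have hw1 : 1 ≤ w := hs1.trans hsw
  have hcinv : 4 / δ ≤ 1 / c := by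
    rw [div_le_div_iff₀ hδ hc]
    linarith
  have hcinv4 : 4 ≤ 1 / c := by
    refine le_trans ?_ hcinv
    rw [le_div_iff₀ hδ]
    linarith
  have hpinv : 1 ≤ 1 / p := by rwa [one_le_div hp]
  have hQ : Q = 3 * t * w * (1 / p) * (1 / c) := by
    rw [hQdef]; field_simp
  have hprod : ∀ {u v : ℝ}, 1 ≤ u → 1 ≤ v → 1 ≤ u * v := fun hu hv =>
    one_le_mul_of_one_le_of_one_le hu hv
  have hc1 : 1 ≤ 1 / c := by linarith
  have hTQ : t ≤ Q := by
    have h := hprod (hprod hw1 hpinv) hc1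
    rw [hQ]
    nlinarith [mul_le_mul_of_nonneg_left h (zero_le_one.trans ht1)]
  have hpQ : 1 / p ≤ Q := by
    have h := hprod (hprod ht1 hw1) hc1
    rw [hQ]
    nlinarith [mul_le_mul_of_nonneg_left h (zero_le_one.trans hpinv)]
  have hwcQ : w * (1 / c) ≤ Q := by
    have h := hprod ht1 hpinv
    have h0 : 0 ≤ w * (1 / c) := by positivity
    rw [hQ]
    nlinarith [mul_le_mul_of_nonneg_left h h0]
  have hcQ : 1 / c ≤ Q := by nlinarith
  have hQ4 : 4 ≤ Q := hcinv4.trans hcQ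
  have hsQ : 4 * s / δ ≤ Q := by
    refine le_trans ?_ hwcQ
    calc 4 * s / δ = s * (4 / δ) := by ring
      _ ≤ w * (1 / c) := by gcongr
  have hΛ1 : 1 ≤ Real.log Q := by
    rw [Real.le_log_iff_exp_le (by linarith)]
    linarith [Real.exp_one_lt_d9]
  set Λ : ℝ := Real.log Q with hΛdef
  -- A union over `s` features, each missed with probability at most `exp (-a)`, costs `δ/4`.
  set a : ℝ := Real.log (4 * s / δ) with hadef
  have h4s : 4 ≤ 4 * s / δ := by
    rw [le_div_iff₀ hδ]
    nlinarith
  have ha0 : 0 ≤ a := Real.log_nonneg (by linarith)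
  have haΛ : a ≤ Λ := Real.log_le_log (by linarith) hsQ
  have hn2 : (⌈(a / p) ^ 2⌉₊ : ℝ) ≤ 2 * Λ ^ 2 / p ^ 2 := by
    have h1 : (⌈(a / p) ^ 2⌉₊ : ℝ) ≤ (a / p) ^ 2 + 1 := (Nat.ceil_lt_add_one (by positivity)).le
    have h2 : (a / p) ^ 2 ≤ Λ ^ 2 / p ^ 2 := by
      rw [div_pow]
      gcongr
    -- Absorbs the rounding by the ceiling.
    have h3 : 1 ≤ Λ ^ 2 / p ^ 2 := by
      rw [one_le_div (by positivity)]
      exact (pow_le_one₀ hp.le hp1).trans (one_le_pow₀ hΛ1)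
    have h4 : 2 * Λ ^ 2 / p ^ 2 = Λ ^ 2 / p ^ 2 + Λ ^ 2 / p ^ 2 := by ring
    linarith
  refine ⟨⌈(a / p) ^ 2⌉₊, a, ?_, ?_, haΛ, hn2, hΛ1, ?_, ?_⟩
  · rw [Real.exp_neg, hadef, Real.exp_log (by linarith), inv_div]
  · have h1 : a / p ≤ Real.sqrt ⌈(a / p) ^ 2⌉₊ := Real.le_sqrt_of_sq_le (Nat.le_ceil _)
    rw [div_le_iff₀ hp] at h1
    linarith
  · have h0 : 0 ≤ ((⌈(a / p) ^ 2⌉₊ : ℝ) + (t - 1)) * h :=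
      mul_nonneg (add_nonneg (Nat.cast_nonneg _) (by linarith)) hh
    have h1 : 1 / c ≤ (1 + ((⌈(a / p) ^ 2⌉₊ : ℝ) + (t - 1)) * h) / c := by
      gcongr
      linarith
    rw [Real.le_log_iff_exp_le (by linarith)]
    linarith [Real.exp_one_lt_d9]
  · exact log_horizon_le hh hc hp (by linarith) hn2 (Nat.cast_nonneg _) (by linarith)
      (by linarith) hpQ hcQ hΛ1

end Constants

/-- With no relevant feature the initial phase may never end, so the discovery argument is
unavailable; but then every action is optimal. -/
theorem Interaction.regret_zero_weight {Ω : Type*} {d : ℕ} {E : Interaction Ω d}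
    (hne : ∀ n ω, (E.actions n ω).Nonempty) (T : ℕ) (ω : Ω) :
    E.regret 0 T ω = 0 := by
  unfold Interaction.regret
  refine ENNReal.tsum_eq_zero.2 fun n => ?_
  rw [ENNReal.ofReal_of_nonpos (Interaction.instRegret_zero n ω (hne n ω)), ite_self]

/-! ### Union bounds over features and feature sets, and the final estimate. -/

section UnionBounds

variable {Ω : Type*} [mΩ : MeasurableSpace Ω] {μ : Measure Ω} [IsProbabilityMeasure μ]
  {d : ℕ} {ℱ 𝒢 : Filtration ℕ mΩ} {E : Interaction Ω d} {θ : Vec d} {N : Finset (Fin d)}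
  {S L R p lam c : ℝ}

namespace Interaction.IsFeatureFeedbackModel

theorem known_subset (hM : E.IsFeatureFeedbackModel μ ℱ 𝒢 θ N S L R p) (n : ℕ) (ω : Ω) :
    E.known n ω ⊆ supp θ ∪ N := by
  intro j hj
  obtain ⟨k, _, hj⟩ := mem_known.1 hj
  exact hM.feedback_subset k ω hj

theorem measure_not_supp_subset_known_le (hM : E.IsFeatureFeedbackModel μ ℱ 𝒢 θ N S L R p)
    (hF : E.IsFFOFUL μ ℱ S L R lam c) (hp : 0 ≤ p) (n : ℕ) :
    μ {ω | ¬ supp θ ⊆ E.known n ω} ≤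
      ENNReal.ofReal ((supp θ).card * Real.exp (-(p * Real.sqrt n))) := by
  have hset : {ω | ¬ supp θ ⊆ E.known n ω} = ⋃ j ∈ supp θ, {ω | j ∉ E.known n ω} := by
    ext ω
    simp [Finset.not_subset]
  rw [hset]
  refine (measure_biUnion_finset_le _ _).trans ?_
  refine (Finset.sum_le_sum fun j hj => hM.measure_notMem_known_le hF hp hj n).trans ?_
  rw [Finset.sum_const, nsmul_eq_mul, ENNReal.ofReal_mul (Nat.cast_nonneg _),
    ENNReal.ofReal_natCast]

/-- The sum factors as `ε ^ |A| (1 + ε) ^ |N|`. The second factor is at most `exp (|N| ε) ≤ exp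
(1/4) ≤ 2`, and `A` nonempty leaves one factor `ε`. -/
theorem sum_powerset_pow_le {α : Type*} [DecidableEq α] {A N : Finset α} (h : Disjoint A N)
    (hA : A.Nonempty) {ε : ℝ} (h0 : 0 ≤ ε) (hε : ε * (4 * (N.card + 1)) ≤ 1) :
    ∑ B ∈ N.powerset, ε ^ (A ∪ B).card ≤ 2 * ε := by
  have hε1 : ε ≤ 1 := by
    have : ε * 1 ≤ ε * (4 * ((N.card : ℝ) + 1)) := by
      gcongr
      have : (0 : ℝ) ≤ N.card := Nat.cast_nonneg _
      linarith
    linarith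
  have h1 : ∀ B ∈ N.powerset, ε ^ (A ∪ B).card = ε ^ A.card * ε ^ B.card := by
    intro B hB
    rw [Finset.card_union_of_disjoint (h.mono_right (Finset.mem_powerset.1 hB)), pow_add]
  have h2 : ∑ B ∈ N.powerset, ε ^ B.card = (ε + 1) ^ N.card := by
    have := Finset.sum_pow_mul_eq_add_pow ε 1 N
    simpa using this
  rw [Finset.sum_congr rfl h1, ← Finset.mul_sum, h2]
  have h3 : (ε + 1) ^ N.card ≤ 2 := by
    calc (ε + 1) ^ N.card ≤ Real.exp ε ^ N.card := by
          gcongr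
          exact Real.add_one_le_exp ε
      _ = Real.exp (N.card * ε) := by rw [← Real.exp_nat_mul]
      _ ≤ Real.exp (1 / 4) := by
          refine Real.exp_le_exp.2 ?_
          nlinarith
      _ ≤ Real.exp (Real.log 2) := by
          refine Real.exp_le_exp.2 ?_
          linarith [Real.log_two_gt_d9]
      _ = 2 := Real.exp_log (by norm_num)
  have h4 : ε ^ A.card ≤ ε := pow_le_of_le_one h0 hε1 (Finset.card_pos.2 hA).ne'
  calc ε ^ A.card * (ε + 1) ^ N.card ≤ ε * 2 := by gcongr
    _ = 2 * ε := by ring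

/-- The confidence ellipsoids on the random sets of known features contain the true parameter from
the time on at which all relevant features are known, with high probability. -/
theorem measure_exists_notMem_confidenceSet_known_le
    (hM : E.IsFeatureFeedbackModel μ ℱ 𝒢 θ N S L R p)
    (hF : E.IsFFOFUL μ ℱ S L R lam c) (hl : 0 < lam) (hR : 0 ≤ R) (hc : 0 < c)
    (hd : Disjoint (supp θ) N) (hne : (supp θ).Nonempty) {ε : ℝ} (h0 : 0 ≤ ε)
    (hε : ε * (4 * (N.card + 1)) ≤ 1) (hcε : c ≤ ε ^ 2) :
    μ {ω | ∃ n, supp θ ⊆ E.known n ω ∧ θ ∉ confidenceSet S L R lam c (E.known n ω)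
      (fun k => E.action k ω) (fun k => E.reward k ω) n} ≤ ENNReal.ofReal (2 * ε) := by
  have hsub : {ω | ∃ n, supp θ ⊆ E.known n ω ∧ θ ∉ confidenceSet S L R lam c (E.known n ω)
      (fun k => E.action k ω) (fun k => E.reward k ω) n} ⊆ ⋃ B ∈ N.powerset,
      {ω | ∃ n, θ ∉ confidenceSet S L R lam c (supp θ ∪ B)
        (fun k => E.action k ω) (fun k => E.reward k ω) n} := by
    rintro ω ⟨n, h1, h2⟩
    have h3 : supp θ ∪ (E.known n ω \ supp θ) = E.known n ω :=
      Finset.union_sdiff_of_subset h1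
    refine Set.mem_biUnion (x := E.known n ω \ supp θ) ?_ ⟨n, by rwa [h3]⟩
    refine Finset.mem_powerset.2 fun j hj => ?_
    rw [Finset.mem_sdiff] at hj
    exact (Finset.mem_union.1 (hM.known_subset n ω hj.1)).resolve_left hj.2
  refine (measure_mono hsub).trans ((measure_biUnion_finset_le _ _).trans ?_)
  have hsq : Real.sqrt c ≤ ε := Real.sqrt_le_iff.2 ⟨h0, hcε⟩
  calc _ ≤ ∑ B ∈ N.powerset, ENNReal.ofReal (ε ^ (supp θ ∪ B).card) := by
        refine Finset.sum_le_sum fun B _ => ?_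
        refine (hM.measure_exists_notMem_confidenceSet_le hF.action_mem hl hR hc
          Finset.subset_union_left).trans (ENNReal.ofReal_le_ofReal ?_)
        gcongr
    _ = ENNReal.ofReal (∑ B ∈ N.powerset, ε ^ (supp θ ∪ B).card) :=
        (ENNReal.ofReal_sum_of_nonneg fun _ _ => by positivity).symm
    _ ≤ ENNReal.ofReal (2 * ε) := ENNReal.ofReal_le_ofReal (sum_powerset_pow_le hd hne h0 hε)

/-- The regret bound for a parameter with at least one relevant feature. -/
theorem measure_regret_gt_le (hM : E.IsFeatureFeedbackModel μ ℱ 𝒢 θ N S L R p)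
    (hF : E.IsFFOFUL μ ℱ S L R lam c) (hS : 0 ≤ S) (hl : 0 < lam) (hR : 0 ≤ R)
    {k k' T : ℕ} {δ : ℝ} (hk : (supp θ).card ≤ k)
    (hd : Disjoint (supp θ) N) (hk' : N.card = k') (hne : (supp θ).Nonempty) (hp : 0 < p)
    (hp1 : p ≤ 1) (hδ : 0 < δ) (hδ1 : δ < 1) (hc : 0 < c) (hcδ : c ≤ (δ / (4 * (k' + 1))) ^ 2) :
    μ {ω | ENNReal.ofReal (regretConst S L R lam *
        Real.log (3 * (T + 1) * (k + k' + 1) / (p * c)) ^ 2 *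
          ((k + k') * Real.sqrt T + 1 / p ^ 2)) < E.regret θ T ω} ≤ ENNReal.ofReal δ := by
  have hs1 : (1 : ℝ) ≤ (supp θ).card := by exact_mod_cast Finset.card_pos.2 hne
  have hsk : ((supp θ).card : ℝ) ≤ k := by exact_mod_cast hk
  have hT0 : (0 : ℝ) ≤ T := Nat.cast_nonneg T
  have hk0 : (0 : ℝ) ≤ k' := Nat.cast_nonneg k'
  -- `ε` is the assumed upper bound on `√c`, the base of the failure probabilities `√c ^ |A|`.
  obtain ⟨ε, hεdef⟩ : ∃ ε, ε = δ / (4 * ((k' : ℝ) + 1)) := ⟨_, rfl⟩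
  rw [← hεdef] at hcδ
  have hε0 : 0 < ε := hεdef ▸ by positivity
  have hεδ : ε ≤ δ / 4 := by
    rw [hεdef]
    gcongr
    linarith
  have hcδ4 : c ≤ δ / 4 := by nlinarith
  have hc1 : c ≤ 1 := by linarith
  have hh : 0 ≤ L ^ 2 / lam := by positivity
  obtain ⟨n, a, hexpa, hpn, haΛ, hn2, hΛ1, hℓ1, hℓ⟩ := exists_discovery_length
    (t := (T : ℝ) + 1) (w := (k : ℝ) + k' + 1) hh hs1 (by linarith) (by linarith) hp hp1 hδ hδ1 hc
    hcδ4 rfl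
  generalize Real.log (3 * ((T : ℝ) + 1) * ((k : ℝ) + k' + 1) / (p * c)) = Λ at *
  have hℓeq : (1 + ((n : ℝ) + ((T : ℝ) + 1 - 1)) * (L ^ 2 / lam)) / c =
      (1 + ((n + T : ℕ) : ℝ) * L ^ 2 / lam) / c := by
    push_cast
    ring
  rw [hℓeq] at hℓ1 hℓ
  have hbase : 0 ≤ ((n + T : ℕ) : ℝ) * L ^ 2 / lam := by positivity
  have hg : Real.log (1 + ((n + T : ℕ) : ℝ) * L ^ 2 / lam) ≤
      Real.log ((1 + ((n + T : ℕ) : ℝ) * L ^ 2 / lam) / c) := by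
    refine Real.log_le_log (by positivity) ?_
    rw [le_div_iff₀ hc]
    exact mul_le_of_le_one_right (by positivity) hc1
  have hr1 : 1 ≤ (k : ℝ) + k' := by linarith
  have hBr : ((supp θ ∪ N).card : ℝ) ≤ (k : ℝ) + k' := by
    have h1 : (supp θ ∪ N).card ≤ k + k' := (Finset.card_union_le _ _).trans (by omega)
    exact_mod_cast h1
  have hrad : ∀ ω, ∀ m < n + T, radius S L R lam c (E.known m ω).card m ≤
      (R + Real.sqrt lam * S + 1) * Real.sqrt (((k : ℝ) + k') *
        Real.log ((1 + ((n + T : ℕ) : ℝ) * L ^ 2 / lam) / c)) := fun ω m hm =>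
    (radius_mono hl hR hc hc1 (Finset.card_le_card (hM.known_subset m ω)) hm.le).trans
      (radius_le hS hR hr1 hBr le_rfl hℓ1)
  generalize Real.log ((1 + ((n + T : ℕ) : ℝ) * L ^ 2 / lam) / c) = ℓ at *
  have hb1 : 1 ≤ (R + Real.sqrt lam * S + 1) * Real.sqrt (((k : ℝ) + k') * ℓ) := by
    have h1 : 1 ≤ Real.sqrt (((k : ℝ) + k') * ℓ) := by
      rw [Real.one_le_sqrt]
      exact one_le_mul_of_one_le_of_one_le hr1 hℓ1
    have h2 : 1 ≤ R + Real.sqrt lam * S + 1 := by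
      have : 0 ≤ Real.sqrt lam * S := by positivity
      linarith
    exact one_le_mul_of_one_le_of_one_le h2 h1
  have hgood : {ω | ENNReal.ofReal (regretConst S L R lam * Λ ^ 2 *
        (((k : ℝ) + k') * Real.sqrt T + 1 / p ^ 2)) < E.regret θ T ω} ⊆
      ({ω | ¬ supp θ ⊆ E.known n ω} ∪
        {ω | a ≤ ∑ i ∈ Finset.range T, (E.exploreInd (n + i) ω - 2 * E.exploreProb (n + i) ω)}) ∪
        {ω | ∃ n, supp θ ⊆ E.known n ω ∧ θ ∉ confidenceSet S L R lam c (E.known n ω)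
          (fun k => E.action k ω) (fun k => E.reward k ω) n} := by
    intro ω hω
    by_contra hbad
    simp only [Set.mem_union, Set.mem_ofPred_eq, not_or, not_not, not_exists, not_and, not_le]
      at hbad
    obtain ⟨⟨hk1, hk2⟩, hk3⟩ := hbad
    rw [Set.mem_ofPred_eq, ← not_le] at hω
    refine hω ?_
    refine (regret_le hM hF hl (fun m => hM.known_subset m ω) hb1 (hrad ω) (hne.mono hk1)
      (fun m hm => hk3 m (hk1.trans (E.known_mono ω hm))) hk2.le).trans
      (ENNReal.ofReal_le_ofReal ?_)
    exact regret_bound_le hS hR hl hr1 hℓ1 hℓ hΛ1 hn2 haΛ hp hp1 (Nat.cast_nonneg _) hBr hg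
  refine (measure_mono hgood).trans ((measure_union_le _ _).trans ?_)
  have hm1 : μ {ω | ¬ supp θ ⊆ E.known n ω} ≤ ENNReal.ofReal (δ / 4) := by
    refine (hM.measure_not_supp_subset_known_le hF hp.le n).trans (ENNReal.ofReal_le_ofReal ?_)
    calc ((supp θ).card : ℝ) * Real.exp (-(p * Real.sqrt n)) ≤
          (supp θ).card * Real.exp (-a) := by gcongr
      _ = δ / 4 := by
        rw [hexpa]
        field_simp
  have hm2 := hM.measure_sum_exploreInd_ge_le hF n T a
  have hm2' : ENNReal.ofReal (Real.exp (-a)) ≤ ENNReal.ofReal (δ / 4) := by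
    rw [hexpa]
    refine ENNReal.ofReal_le_ofReal ?_
    gcongr
    linarith
  have hεN : ε * (4 * ((N.card : ℝ) + 1)) ≤ 1 := by
    rw [hk', hεdef, div_mul_cancel₀ _ (by positivity)]
    exact hδ1.le
  have hm3 := hM.measure_exists_notMem_confidenceSet_known_le hF hl hR hc hd hne hε0.le hεN hcδ
  -- Discovery and exploration fail with probability at most `δ/4` each, confidence with at most `2
  -- ε ≤ δ/2`.
  calc _ ≤ (ENNReal.ofReal (δ / 4) + ENNReal.ofReal (δ / 4)) + ENNReal.ofReal (2 * ε) :=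
        add_le_add ((measure_union_le _ _).trans (add_le_add hm1 (hm2.trans hm2'))) hm3
    _ = ENNReal.ofReal (δ / 4 + δ / 4 + 2 * ε) := by
        rw [← ENNReal.ofReal_add (by positivity) (by positivity),
          ← ENNReal.ofReal_add (by positivity) (by positivity)]
    _ ≤ ENNReal.ofReal δ := ENNReal.ofReal_le_ofReal (by linarith)

end Interaction.IsFeatureFeedbackModel

end UnionBounds

end FFOFUL

theorem corollary1 :
    ∃ a : ℕ, ∀ S L R lam : ℝ, 0 ≤ S → 0 ≤ L → 0 ≤ R → 0 < lam →
    ∃ C : ℝ, 0 < C ∧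
    ∀ (Ω : Type*) (mΩ : MeasurableSpace Ω) (μ : Measure Ω) (_ : IsProbabilityMeasure μ)
      (ℱ 𝒢 : Filtration ℕ mΩ) (d k k' T : ℕ) (p δ c : ℝ)
      (E : FFOFUL.Interaction Ω d) (θ : FFOFUL.Vec d) (N : Finset (Fin d)),
      (FFOFUL.supp θ).card ≤ k → Disjoint (FFOFUL.supp θ) N → N.card = k' →
      0 < p → p ≤ 1 → 0 < δ → δ < 1 →
      0 < c → c ≤ (δ / (4 * (k' + 1))) ^ 2 →
      E.IsFeatureFeedbackModel μ ℱ 𝒢 θ N S L R p →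
      E.IsFFOFUL μ ℱ S L R lam c →
      μ {ω | ENNReal.ofReal
            (C * Real.log (3 * (T + 1) * (k + k' + 1) / (p * c)) ^ a *
              ((k + k') * Real.sqrt T + 1 / p ^ 2)) < E.regret θ T ω}
        ≤ ENNReal.ofReal δ := by
  refine ⟨2, fun S L R lam hS _ hR hl => ⟨FFOFUL.regretConst S L R lam,
    FFOFUL.regretConst_pos hS hR hl, ?_⟩⟩
  intro Ω mΩ μ _ ℱ 𝒢 d k k' T p δ c E θ N hk hd hk' hp hp1 hδ hδ1 hc hcδ hM hF
  rcases (FFOFUL.supp θ).eq_empty_or_nonempty with h | h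
  · have hθ : θ = 0 := by
      ext i
      by_contra hi
      exact Finset.notMem_empty i (h ▸ by simpa [FFOFUL.supp] using hi)
    subst hθ
    simp [FFOFUL.Interaction.regret_zero_weight hM.actions_nonempty]
  · exact hM.measure_regret_gt_le hF hS hl hR hk hd hk' h hp hp1 hδ hδ1 hc hcδ
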